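/- For integers $1\le r\le t$ and $n\ge 1$ let $D_{r,t}(n)$ be the total number of parts congruent to $r$ modulo $t$, summed over all partitions of $n$ into distinct parts. Let $B_k(x)$ denote the Bernoulli polynomials, $\sum_{k\ge 0}B_k(x)\frac{u^k}{k!}=\frac{ue^{xu}}{e^u-1}$. Put $\eta=\frac{\pi}{\sqrt{12n}}$ and, for integers $s\ge 0$, $$V_s(n):=\frac{1}{2\pi\sqrt2\,i}\int_{\eta-10\eta i}^{\eta+10\eta i} z^{s-1}\exp\!\left(\frac{\pi^2}{12z}+\left(n+\tfrac1{24}\right)z\right)dz,$$ where the path is the straight line segment, and $$\mathrm{Err}_t(n):=\frac{14381\,t^5}{n^3}e^{\pi\sqrt{n/3}}+\frac{945285959087}{t\,n^4}e^{\pi\sqrt{n/3}}+9n\exp\!\left(\left(\frac{3\sqrt3}{2\pi}+\frac{\pi}{\sqrt{12}}\right)\sqrt n\right).$$ Then for all integers $t\ge 2$, $1\le r\le t$ and $n>\frac{400t^2}{3}$, $$\left|D_{r,t}(n)-\frac{\log 2}{t}V_0(n)+\frac12B_1\!\left(\frac rt\right)V_1(n)-\frac t8B_2\!\left(\frac rt\right)V_2(n)+\frac{t^3}{192}B_4\!\left(\frac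 rt\right)V_4(n)\right|\le \mathrm{Err}_t(n).$$ -/

import Mathlib

namespace DistinctParts

noncomputable section

/-- `D_{r,t}(n)`: the total number of parts congruent to `r` modulo `t`, summed over all
partitions of `n` into distinct parts. -/
def D (r t n : ℕ) : ℕ :=
  ∑ p ∈ Nat.Partition.distincts n, (p.parts.filter (fun m => m ≡ r [MOD t])).card

/-- The abscissa `η = π / √(12 n)`; the circle of integration is `|q| = exp (-η)`. -/
def eta (n : ℕ) : ℝ := Real.pi / √(12 * (n : ℝ))

/-- The point `z = η + i y`, where `q = exp (-z)`. The major arc is `-10 η < y < 10 η`. -/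
def arcPoint (n : ℕ) (y : ℝ) : ℂ := (eta n : ℂ) + (y : ℂ) * Complex.I

/-- The major-arc integral
`V_s(n) = 1 / (2 π √2 i) ∫ z ^ (s - 1) exp (π² / (12 z) + (n + 1 / 24) z) dz`,
taken along the vertical segment from `η - 10 η i` to `η + 10 η i`, parametrised as
`z = η + i y`, `dz = i dy`. The exponent `s - 1` is an integer (it is `-1` for `s = 0`). -/
def V (s n : ℕ) : ℂ :=
  1 / (2 * (Real.pi : ℂ) * ((√2 : ℝ) : ℂ) * Complex.I) *
    ∫ y in (-(10 * eta n))..(10 * eta n),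
      arcPoint n y ^ ((s : ℤ) - 1) *
        Complex.exp ((Real.pi : ℂ) ^ 2 / (12 * arcPoint n y)
          + ((n : ℂ) + 1 / 24) * arcPoint n y) * Complex.I

/-- The value `B_k(x)` of the `k`-th Bernoulli polynomial at a real number `x`. -/
def bern (k : ℕ) (x : ℝ) : ℝ := Polynomial.aeval x (Polynomial.bernoulli k)

/-- The explicit error bound `Err_t(n)`. -/
def Err (t n : ℕ) : ℝ :=
  14381 * (t : ℝ) ^ 5 / (n : ℝ) ^ 3 * Real.exp (Real.pi * √((n : ℝ) / 3))
    + 945285959087 / ((t : ℝ) * (n : ℝ) ^ 4) * Real.exp (Real.pi * √((n : ℝ) / 3))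
    + 9 * (n : ℝ) * Real.exp ((3 * √3 / (2 * Real.pi) + Real.pi / √12) * √(n : ℝ))

end

end DistinctParts

/-! With `q = e ^ (-z)`, `z = η + i y`, the generating function of `D r t` is `P(z) L(z)`, where
`P = ∏ (1 + q ^ m)` and `L = ∑ q ^ m / (1 + q ^ m)` over `m ≡ r (mod t)`. Cauchy's formula
(`integral_eq_D`) writes `2 π D r t n` as the integral of `P(z) L(z) e ^ (n z)` over `|y| ≤ π`.

For `|y| ≤ η / 2` both `log P` and `L` are sums of the shape `∑ F ((j + a) w)`, with
`F = log (1 + e ^ (-x))` and `F = 1 / (e ^ x + 1)`, and Euler–Maclaurin summation along the ray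
through `w` (`norm_sum_sub_integral_add_le`) expands them; no modular transformation is needed. The
expansion of `L` (`norm_lambertSum_sub_le`) gives the four main terms with an error
`O ((t η) ^ 5)`, and that of `log P` (`norm_logDistinctGen_sub_le`) terminates with an error
`O (η ^ 6)`. In both cases the remainder involves the sixth derivative of `1 / (e ^ x + 1)`. Since
`e ^ (π √(n / 3)) = e ^ (2 n η)`, integration over an interval of length `η` yields the `t ^ 5 / n ^ 3`
term of the error bound.

For `η / 2 ≤ |y| ≤ π` everything is absorbed by the last error term, whose exponent is
`3 / (4 η) + n η`. By Euler, `P = ∏ 1 / (1 - q ^ m)` over odd `m`. The logarithm of `1 / |1 - q ^ m|`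
has nonnegative coefficients, so its excess over the real point `|q|` is at most that of its linear
term; summing over odd `m` bounds `log |P(z)|` by
`log P(η) + Re (1 / (2 sinh z)) - 1 / (2 sinh η)` (`re_logDistinctGen_le`), which is at most
`3 / (4 η)` because `log P(η) ≤ π ^ 2 / (12 η)` and the two remaining terms together are at most
`-2 / (25 η)` (`inv_two_sinh_gap`). On the part `η / 2 ≤ |y| ≤ 10 η` of the segments
defining `V s n` the integrands are bounded by the same exponential. -/

namespace DistinctParts

noncomputable section

open Filter Topology MeasureTheory Set

/-! ### The generating function and its coefficients -/

/-- The multiset of parts identifies the partitions of `n` into distinct parts with the sets of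
positive integers with sum `n`. -/
lemma D_eq_sum_powerset (r t n : ℕ) {M : ℕ} (hM : n ≤ M) :
    D r t n = ∑ S ∈ (Finset.Icc 1 M).powerset with ∑ m ∈ S, m = n,
      (S.filter (fun m => m ≡ r [MOD t])).card := by
  unfold D
  refine Finset.sum_bij (fun p _ => p.parts.toFinset) ?_ ?_ ?_ ?_
  · intro p hp
    have hnd : p.parts.Nodup := (Finset.mem_filter.1 hp).2
    rw [Finset.mem_filter, Finset.mem_powerset]
    have hs : ∑ m ∈ p.parts.toFinset, m = n := by
      have := p.parts_sum
      rw [Finset.sum_eq_multiset_sum, Multiset.toFinset_val, hnd.dedup, Multiset.map_id']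
      exact this
    refine ⟨?_, hs⟩
    intro m hm
    have hm' := Multiset.mem_toFinset.1 hm
    rw [Finset.mem_Icc]
    refine ⟨p.parts_pos hm', le_trans ?_ hM⟩
    rw [← p.parts_sum]
    exact Multiset.single_le_sum (fun _ _ => Nat.zero_le _) _ hm'
  · intro p hp q hq h
    have hp' : p.parts.Nodup := (Finset.mem_filter.1 hp).2
    have hq' : q.parts.Nodup := (Finset.mem_filter.1 hq).2
    apply Nat.Partition.ext
    have := congrArg Finset.val h
    simpa [Multiset.toFinset_val, hp'.dedup, hq'.dedup] using this
  · intro S hS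
    rw [Finset.mem_filter, Finset.mem_powerset] at hS
    refine ⟨⟨S.val, ?_, ?_⟩, ?_, ?_⟩
    · intro i hi
      exact (Finset.mem_Icc.1 (hS.1 hi)).1
    · rw [← hS.2, Finset.sum_eq_multiset_sum, Multiset.map_id']
    · simp only [Nat.Partition.distincts, Finset.mem_filter, Finset.mem_univ, true_and]
      exact S.nodup
    · simp
  · intro p hp
    have hp' : p.parts.Nodup := (Finset.mem_filter.1 hp).2
    rw [Finset.card_def, Finset.filter_val, Multiset.toFinset_val, hp'.dedup]

/-- Truncation of the generating function of `D r t`: the coefficient of `q ^ n` is `D r t n`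
as soon as `n ≤ M`. -/
def genTrunc (r t M : ℕ) (q : ℂ) : ℂ :=
  (∏ m ∈ Finset.Icc 1 M, (1 + q ^ m)) *
    ∑ m ∈ Finset.Icc 1 M with m ≡ r [MOD t], q ^ m / (1 + q ^ m)

lemma genTrunc_eq_sum_powerset (r t M : ℕ) {q : ℂ} (hq : ∀ m : ℕ, 1 ≤ m → 1 + q ^ m ≠ 0) :
    genTrunc r t M q = ∑ S ∈ (Finset.Icc 1 M).powerset,
      ((S.filter (fun m => m ≡ r [MOD t])).card : ℂ) * q ^ (∑ m ∈ S, m) := by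
  have h1 : ∀ m ∈ Finset.Icc 1 M, (∏ j ∈ Finset.Icc 1 M, (1 + q ^ j)) * (q ^ m / (1 + q ^ m))
      = ∑ S ∈ (Finset.Icc 1 M).powerset, if m ∈ S then q ^ (∑ m ∈ S, m) else 0 := by
    intro m hm
    have hins : Finset.Icc 1 M = insert m ((Finset.Icc 1 M).erase m) :=
      (Finset.insert_erase hm).symm
    have hne := hq m (Finset.mem_Icc.1 hm).1
    rw [← Finset.mul_prod_erase _ _ hm]
    have : (1 + q ^ m) * (∏ x ∈ (Finset.Icc 1 M).erase m, (1 + q ^ x)) * (q ^ m / (1 + q ^ m))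
        = q ^ m * ∏ x ∈ (Finset.Icc 1 M).erase m, (1 + q ^ x) := by
      field_simp
    rw [this]
    conv_rhs => rw [hins]
    have hnot : m ∉ (Finset.Icc 1 M).erase m := Finset.notMem_erase m _
    have hz : ∑ S ∈ ((Finset.Icc 1 M).erase m).powerset,
        (if m ∈ S then q ^ (∑ m ∈ S, m) else 0) = 0 :=
      Finset.sum_eq_zero fun S hS => if_neg fun h => hnot (Finset.mem_powerset.1 hS h)
    rw [Finset.sum_powerset_insert hnot, Finset.prod_one_add, Finset.mul_sum, hz, zero_add]
    · refine Finset.sum_congr rfl fun S hS => ?_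
      have hmS : m ∉ S := fun h => hnot (Finset.mem_powerset.1 hS h)
      rw [if_pos (Finset.mem_insert_self _ _), Finset.sum_insert hmS, pow_add,
        Finset.prod_pow_eq_pow_sum]
  unfold genTrunc
  rw [Finset.mul_sum, Finset.sum_congr rfl fun m hm => h1 m (Finset.mem_filter.1 hm).1,
    Finset.sum_comm]
  refine Finset.sum_congr rfl fun S hS => ?_
  rw [← Finset.sum_filter, Finset.sum_const, nsmul_eq_mul]
  congr 3
  ext m
  simp only [Finset.mem_filter]
  constructor
  · rintro ⟨⟨_, h⟩, h'⟩; exact ⟨h', h⟩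
  · rintro ⟨h', h⟩; exact ⟨⟨Finset.mem_powerset.1 hS h', h⟩, h'⟩

lemma one_add_exp_neg_ne_zero {w : ℂ} (hw : 0 < w.re) : 1 + Complex.exp (-w) ≠ 0 := by
  intro h
  have h1 : Complex.exp (-w) = -1 := by linear_combination h
  have h2 := congrArg norm h1
  rw [Complex.norm_exp, Complex.neg_re, norm_neg, norm_one, Real.exp_eq_one_iff] at h2
  linarith

lemma integral_exp_int_mul_I (k : ℤ) :
    ∫ y in (-Real.pi)..Real.pi, Complex.exp ((k : ℂ) * Complex.I * (y : ℂ))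
      = if k = 0 then 2 * (Real.pi : ℂ) else 0 := by
  split_ifs with hk
  · simp only [hk, Int.cast_zero, zero_mul, Complex.exp_zero, intervalIntegral.integral_const,
      Complex.real_smul, mul_one]
    push_cast; ring
  · have hc : (k : ℂ) * Complex.I ≠ 0 := mul_ne_zero (by exact_mod_cast hk) Complex.I_ne_zero
    rw [integral_exp_mul_complex hc, div_eq_zero_iff]
    left
    rw [sub_eq_zero, Complex.exp_eq_exp_iff_exists_int]
    exact ⟨k, by push_cast; ring⟩

/-- Cauchy's formula for the coefficients of the truncated generating function on the circle
`|q| = e ^ (-η)`. -/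
lemma integral_genTrunc (r t n : ℕ) {M : ℕ} (hM : n ≤ M) {η : ℝ} (hη : 0 < η) :
    ∫ y in (-Real.pi)..Real.pi, genTrunc r t M (Complex.exp (-((η : ℂ) + y * Complex.I))) *
      Complex.exp (n * ((η : ℂ) + y * Complex.I)) = 2 * (Real.pi : ℂ) * (D r t n : ℂ) := by
  have hq : ∀ y : ℝ, ∀ m : ℕ, 1 ≤ m →
      1 + Complex.exp (-((η : ℂ) + y * Complex.I)) ^ m ≠ 0 := by
    intro y m hm
    rw [← Complex.exp_nat_mul, mul_neg]
    apply one_add_exp_neg_ne_zero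
    have : (0 : ℝ) < m := by exact_mod_cast hm
    simp [hη, this]
  have h1 : ∀ y : ℝ, genTrunc r t M (Complex.exp (-((η : ℂ) + y * Complex.I))) *
      Complex.exp (n * ((η : ℂ) + y * Complex.I)) =
      ∑ S ∈ (Finset.Icc 1 M).powerset, ((S.filter (fun m => m ≡ r [MOD t])).card : ℂ) *
        (Complex.exp (((n : ℂ) - ((∑ m ∈ S, m : ℕ) : ℂ)) * η) *
        Complex.exp ((((n : ℤ) - ((∑ m ∈ S, m : ℕ) : ℤ) : ℤ) : ℂ) * Complex.I * y)) := by
    intro y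
    rw [genTrunc_eq_sum_powerset r t M (hq y), Finset.sum_mul]
    refine Finset.sum_congr rfl fun S _ => ?_
    rw [mul_assoc, ← Complex.exp_nat_mul, ← Complex.exp_add, ← Complex.exp_add]
    congr 2
    push_cast
    ring
  simp only [h1]
  rw [intervalIntegral.integral_finsetSum fun S _ =>
    Continuous.intervalIntegrable (by fun_prop) _ _]
  simp only [intervalIntegral.integral_const_mul, integral_exp_int_mul_I]
  rw [D_eq_sum_powerset r t n hM, Finset.sum_filter]
  push_cast
  rw [Finset.mul_sum]
  refine Finset.sum_congr rfl fun S _ => ?_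
  by_cases h : ∑ m ∈ S, m = n
  · have h0 : ((n : ℤ) - ((∑ m ∈ S, m : ℕ) : ℤ)) = 0 := by rw [h]; ring
    have h0' : ((n : ℂ) - ((∑ m ∈ S, m : ℕ) : ℂ)) = 0 := by rw [h]; ring
    push_cast at h0 h0'
    rw [if_pos h, if_pos h0, h0']
    simp
    ring
  · have h0 : ¬ ((n : ℤ) - ((∑ m ∈ S, m : ℕ) : ℤ)) = 0 := by
      intro h'; apply h; exact_mod_cast (sub_eq_zero.1 h').symm
    push_cast at h0
    rw [if_neg h, if_neg h0]
    simp

end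

end DistinctParts

namespace DistinctParts

noncomputable section

open Filter Topology MeasureTheory Set

/-! ### Euler–Maclaurin summation -/

/-- The normalised Bernoulli polynomial `B_k(x) / k!`, so that each one is the derivative of
the next. -/
def bernNorm (k : ℕ) (x : ℝ) : ℝ := bernoulliFun k x / (k.factorial : ℝ)

lemma bernNorm_zero (x : ℝ) : bernNorm 0 x = 1 := by simp [bernNorm]

lemma hasDerivAt_bernNorm (k : ℕ) (x : ℝ) :
    HasDerivAt (bernNorm (k + 1)) (bernNorm k x) x := by
  have h := (hasDerivAt_bernoulliFun (k + 1) x).div_const ((k + 1).factorial : ℝ)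
  refine h.congr_deriv ?_
  have : (k.factorial : ℝ) ≠ 0 := by positivity
  simp only [bernNorm, Nat.factorial_succ, Nat.add_sub_cancel]
  push_cast
  field_simp

lemma continuous_bernNorm (k : ℕ) : Continuous (bernNorm k) :=
  (continuous_bernoulliFun k).div_const _

lemma integral_bernNorm_succ (k : ℕ) : ∫ x in (0 : ℝ)..1, bernNorm (k + 1) x = 0 := by
  simp only [bernNorm]
  rw [intervalIntegral.integral_div, integral_bernoulliFun_eq_zero (Nat.succ_ne_zero k), zero_div]

/-- A function of mean zero on `[0, 1]` is bounded by the `L¹` norm of its derivative. -/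
lemma norm_le_integral_norm_deriv_of_integral_eq_zero {F F' : ℝ → ℂ}
    (hF : ∀ x ∈ Icc (0 : ℝ) 1, HasDerivAt F (F' x) x) (hF' : ContinuousOn F' (Icc 0 1))
    (h0 : ∫ x in (0 : ℝ)..1, F x = 0) {a : ℝ} (ha : a ∈ Icc (0 : ℝ) 1) :
    ‖F a‖ ≤ ∫ x in (0 : ℝ)..1, ‖F' x‖ := by
  have hI : IntervalIntegrable F' volume 0 1 :=
    hF'.intervalIntegrable_of_Icc zero_le_one
  have hFc : ContinuousOn F (Icc 0 1) := fun x hx => (hF x hx).continuousAt.continuousWithinAt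
  have hFI : IntervalIntegrable F volume 0 1 := hFc.intervalIntegrable_of_Icc zero_le_one
  have key : ∀ b ∈ Icc (0 : ℝ) 1, ‖F a - F b‖ ≤ ∫ x in (0 : ℝ)..1, ‖F' x‖ := by
    intro b hb
    have hsub : uIcc b a ⊆ Icc 0 1 := by
      apply uIcc_subset_Icc hb ha
    have e : ∫ x in b..a, F' x = F a - F b := by
      apply intervalIntegral.integral_eq_sub_of_hasDerivAt
      · intro x hx; exact hF x (hsub hx)
      · exact (hF'.mono hsub).intervalIntegrable
    rw [← e]
    refine (intervalIntegral.norm_integral_le_integral_norm_uIoc).trans ?_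
    rw [intervalIntegral.integral_of_le zero_le_one]
    apply setIntegral_mono_set
    · exact ((intervalIntegrable_iff_integrableOn_Ioc_of_le zero_le_one).1 hI).norm
    · exact Eventually.of_forall fun x => norm_nonneg _
    · refine (Ioc_subset_Ioc ?_ ?_).eventuallyLE
      · exact le_min hb.1 ha.1
      · exact max_le hb.2 ha.2
  have e2 : F a = ∫ b in (0 : ℝ)..1, (F a - F b) := by
    rw [intervalIntegral.integral_sub intervalIntegrable_const hFI, h0]
    simp
  rw [e2]
  have := intervalIntegral.norm_integral_le_of_norm_le_const (a := (0 : ℝ)) (b := 1)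
    (f := fun b => F a - F b) (C := ∫ x in (0 : ℝ)..1, ‖F' x‖) (by
      intro x hx
      rw [uIoc_of_le zero_le_one] at hx
      exact key x ⟨hx.1.le, hx.2⟩)
  simpa using this

lemma abs_bernNorm_le (k : ℕ) {a : ℝ} (ha : a ∈ Icc (0 : ℝ) 1) : |bernNorm (k + 1) a| ≤ 1 / 2 := by
  induction k generalizing a with
  | zero =>
    simp only [bernNorm, zero_add, bernoulliFun_one, Nat.factorial_one, Nat.cast_one, div_one]
    rw [abs_le]; constructor <;> linarith [ha.1, ha.2]
  | succ k ih =>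
    have h := norm_le_integral_norm_deriv_of_integral_eq_zero
      (F := fun x => (bernNorm (k + 2) x : ℂ)) (F' := fun x => (bernNorm (k + 1) x : ℂ))
      (fun x _ => (hasDerivAt_bernNorm (k + 1) x).ofReal_comp)
      (Complex.continuous_ofReal.comp (continuous_bernNorm _)).continuousOn
      (by rw [intervalIntegral.integral_ofReal, integral_bernNorm_succ]; simp) ha
    simp only [Complex.norm_real, Real.norm_eq_abs] at h
    refine h.trans ?_
    have : ∫ x in (0 : ℝ)..1, |bernNorm (k + 1) x| ≤ ∫ x in (0 : ℝ)..1, (1 / 2 : ℝ) := by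
      apply intervalIntegral.integral_mono_on zero_le_one
      · exact (continuous_bernNorm _).abs.intervalIntegrable _ _
      · exact intervalIntegrable_const
      · intro x hx; exact ih hx
    simpa using this

/-- The remainder of order `N` in the Euler–Maclaurin formula on `[0, 1]` with evaluation point
`a`, for a function `G 0` whose successive derivatives are `G 1, G 2, …`. -/
def emRem (N : ℕ) (G : ℕ → ℝ → ℂ) (a : ℝ) : ℂ :=
  G 0 a - (∫ x in (0 : ℝ)..1, G 0 x)
    - ∑ k ∈ Finset.range N, (bernNorm (k + 1) a : ℂ) * (G k 1 - G k 0)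

section local_bound

variable {G : ℕ → ℝ → ℂ}

lemma continuousOn_of_chain (hG : ∀ k, ∀ x ∈ Icc (0 : ℝ) 1, HasDerivAt (G k) (G (k + 1) x) x)
    (k : ℕ) : ContinuousOn (G k) (Icc 0 1) :=
  fun x hx => (hG k x hx).continuousAt.continuousWithinAt

/-- Differentiating the remainder in the evaluation point lowers the order by one and shifts the
chain of derivatives. -/
lemma hasDerivAt_emRem (hG : ∀ k, ∀ x ∈ Icc (0 : ℝ) 1, HasDerivAt (G k) (G (k + 1) x) x)
    (N : ℕ) {a : ℝ} (ha : a ∈ Icc (0 : ℝ) 1) :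
    HasDerivAt (emRem (N + 1) G) (emRem N (fun k => G (k + 1)) a) a := by
  have h1 : HasDerivAt (fun a => ∑ k ∈ Finset.range (N + 1),
      (bernNorm (k + 1) a : ℂ) * (G k 1 - G k 0))
      (∑ k ∈ Finset.range (N + 1), (bernNorm k a : ℂ) * (G k 1 - G k 0)) a :=
    HasDerivAt.fun_sum fun k _ => ((hasDerivAt_bernNorm k a).ofReal_comp).mul_const _
  have h2 := ((hG 0 a ha).sub_const (∫ x in (0 : ℝ)..1, G 0 x)).sub h1
  refine h2.congr_deriv ?_
  have e : ∫ x in (0 : ℝ)..1, G 1 x = G 0 1 - G 0 0 := by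
    apply intervalIntegral.integral_eq_sub_of_hasDerivAt
    · intro x hx
      rw [uIcc_of_le zero_le_one] at hx
      exact hG 0 x hx
    · exact (continuousOn_of_chain hG 1).intervalIntegrable_of_Icc zero_le_one
  simp only [emRem, zero_add, e]
  rw [Finset.sum_range_succ', bernNorm_zero]
  simp only [Complex.ofReal_one, one_mul]
  ring

lemma continuousOn_emRem (hG : ∀ k, ∀ x ∈ Icc (0 : ℝ) 1, HasDerivAt (G k) (G (k + 1) x) x)
    (N : ℕ) : ContinuousOn (emRem N G) (Icc 0 1) := by
  unfold emRem
  refine ((continuousOn_of_chain hG 0).sub continuousOn_const).sub ?_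
  refine continuousOn_finsetSum _ fun k _ => ?_
  exact ((Complex.continuous_ofReal.comp (continuous_bernNorm _)).continuousOn).mul
    continuousOn_const

lemma integral_emRem (hG : ∀ k, ∀ x ∈ Icc (0 : ℝ) 1, HasDerivAt (G k) (G (k + 1) x) x)
    (N : ℕ) : ∫ a in (0 : ℝ)..1, emRem N G a = 0 := by
  have hi : IntervalIntegrable (G 0) volume 0 1 :=
    (continuousOn_of_chain hG 0).intervalIntegrable_of_Icc zero_le_one
  have hs : ∀ k ∈ Finset.range N, IntervalIntegrable
      (fun a => (bernNorm (k + 1) a : ℂ) * (G k 1 - G k 0)) volume 0 1 := fun k _ =>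
    ((Complex.continuous_ofReal.comp (continuous_bernNorm _)).mul
      continuous_const).intervalIntegrable _ _
  unfold emRem
  rw [intervalIntegral.integral_sub (hi.sub intervalIntegrable_const)
      (by simpa [Finset.sum_fn] using IntervalIntegrable.sum _ hs),
    intervalIntegral.integral_sub hi intervalIntegrable_const,
    intervalIntegral.integral_finsetSum hs]
  have : ∀ k ∈ Finset.range N, ∫ a in (0 : ℝ)..1, (bernNorm (k + 1) a : ℂ) * (G k 1 - G k 0)
      = 0 := by
    intro k _
    rw [intervalIntegral.integral_mul_const, intervalIntegral.integral_ofReal,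
      integral_bernNorm_succ]
    simp
  rw [Finset.sum_eq_zero this]
  simp

lemma norm_emRem_succ_le_integral
    (hG : ∀ k, ∀ x ∈ Icc (0 : ℝ) 1, HasDerivAt (G k) (G (k + 1) x) x)
    (N : ℕ) {a : ℝ} (ha : a ∈ Icc (0 : ℝ) 1) :
    ‖emRem (N + 1) G a‖ ≤ ∫ x in (0 : ℝ)..1, ‖emRem N (fun k => G (k + 1)) x‖ :=
  norm_le_integral_norm_deriv_of_integral_eq_zero (fun _ hx => hasDerivAt_emRem hG N hx)
    (continuousOn_emRem (fun k => hG (k + 1)) N) (integral_emRem hG (N + 1)) ha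

lemma integral_norm_emRem_le (N : ℕ)
    (hG : ∀ k, ∀ x ∈ Icc (0 : ℝ) 1, HasDerivAt (G k) (G (k + 1) x) x) :
    ∫ a in (0 : ℝ)..1, ‖emRem N G a‖ ≤ 2 * ∫ x in (0 : ℝ)..1, ‖G N x‖ := by
  induction N generalizing G with
  | zero =>
    have hi : IntervalIntegrable (fun x => ‖G 0 x‖) volume 0 1 :=
      (continuousOn_of_chain hG 0).norm.intervalIntegrable_of_Icc zero_le_one
    have : ∫ a in (0 : ℝ)..1, ‖emRem 0 G a‖
        ≤ ∫ a in (0 : ℝ)..1, (‖G 0 a‖ + ∫ x in (0 : ℝ)..1, ‖G 0 x‖) := by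
      apply intervalIntegral.integral_mono_on zero_le_one
      · exact (continuousOn_emRem hG 0).norm.intervalIntegrable_of_Icc zero_le_one
      · exact hi.add intervalIntegrable_const
      · intro x _
        simp only [emRem, Finset.range_zero, Finset.sum_empty, sub_zero]
        exact (norm_sub_le _ _).trans (add_le_add le_rfl
          (intervalIntegral.norm_integral_le_integral_norm zero_le_one))
    rw [intervalIntegral.integral_add hi intervalIntegrable_const] at this
    simp only [intervalIntegral.integral_const, sub_zero, one_smul] at this
    linarith
  | succ N ih =>
    refine le_trans ?_ (ih (G := fun k => G (k + 1)) fun k => hG (k + 1))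
    have : ∫ a in (0 : ℝ)..1, ‖emRem (N + 1) G a‖
        ≤ ∫ a in (0 : ℝ)..1, (∫ x in (0 : ℝ)..1, ‖emRem N (fun k => G (k + 1)) x‖) := by
      apply intervalIntegral.integral_mono_on zero_le_one
      · exact (continuousOn_emRem hG _).norm.intervalIntegrable_of_Icc zero_le_one
      · exact intervalIntegrable_const
      · intro x hx
        exact norm_emRem_succ_le_integral hG N hx
    simpa using this

lemma norm_emRem_succ_le (N : ℕ)
    (hG : ∀ k, ∀ x ∈ Icc (0 : ℝ) 1, HasDerivAt (G k) (G (k + 1) x) x)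
    {a : ℝ} (ha : a ∈ Icc (0 : ℝ) 1) :
    ‖emRem (N + 1) G a‖ ≤ 2 * ∫ x in (0 : ℝ)..1, ‖G (N + 1) x‖ :=
  (norm_emRem_succ_le_integral hG N ha).trans
    (integral_norm_emRem_le N (G := fun k => G (k + 1)) fun k => hG (k + 1))

end local_bound

/-- Euler–Maclaurin summation on the half line with evaluation points `j + a`, the remainder being
bounded by twice the `L¹` norm of the derivative of order `N + 1`. -/
theorem norm_sum_sub_integral_add_le {G : ℕ → ℝ → ℂ}
    (hG : ∀ k, ∀ x, 0 ≤ x → HasDerivAt (G k) (G (k + 1) x) x) (N : ℕ) {C c : ℝ} (hc : 0 < c)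
    (hC : ∀ x, 0 ≤ x → ‖G (N + 1) x‖ ≤ C * Real.exp (-(c * x)))
    (hlim : ∀ k, Tendsto (G k) atTop (𝓝 0)) {a : ℝ} (ha : a ∈ Icc (0 : ℝ) 1) {I S : ℂ}
    (hI : Tendsto (fun J : ℕ => ∫ x in (0 : ℝ)..J, G 0 x) atTop (𝓝 I))
    (hS : Tendsto (fun J : ℕ => ∑ j ∈ Finset.range J, G 0 (j + a)) atTop (𝓝 S)) :
    ‖S - I + ∑ k ∈ Finset.range (N + 1), (bernNorm (k + 1) a : ℂ) * G k 0‖ ≤ 2 * C / c := by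
  have hC0 : 0 ≤ C := by
    have := (norm_nonneg _).trans (hC 0 le_rfl)
    simpa using this
  have hcont : ∀ k, ContinuousOn (G k) (Ici 0) := fun k x hx =>
    (hG k x hx).continuousAt.continuousWithinAt
  have hint : ∀ k (u v : ℝ), 0 ≤ u → 0 ≤ v → IntervalIntegrable (G k) volume u v := by
    intro k u v hu hv
    apply ((hcont k).mono _).intervalIntegrable
    intro x hx
    exact (le_min hu hv).trans hx.1
  -- the formula on the interval `[j, j + 1]`
  have hloc : ∀ j : ℕ, ‖G 0 (j + a) - (∫ x in (j : ℝ)..(j + 1 : ℕ), G 0 x)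
      - ∑ k ∈ Finset.range (N + 1), (bernNorm (k + 1) a : ℂ) * (G k ((j + 1 : ℕ) : ℝ) - G k j)‖
      ≤ 2 * ∫ x in (j : ℝ)..(j + 1 : ℕ), ‖G (N + 1) x‖ := by
    intro j
    have h := norm_emRem_succ_le N (G := fun k x => G k (x + j)) (fun k x hx =>
      (hG k (x + j) (add_nonneg hx.1 (Nat.cast_nonneg j))).comp_add_const x (j : ℝ)) ha
    simp only [emRem] at h
    rw [intervalIntegral.integral_comp_add_right (fun x => G 0 x),
      intervalIntegral.integral_comp_add_right (fun x => ‖G (N + 1) x‖)] at h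
    simp only [zero_add] at h
    push_cast
    rw [add_comm (j : ℝ) a, add_comm (j : ℝ) 1]
    exact h
  have hsum : ∀ J : ℕ, ‖(∑ j ∈ Finset.range J, G 0 (j + a)) - (∫ x in (0 : ℝ)..J, G 0 x)
      - ∑ k ∈ Finset.range (N + 1), (bernNorm (k + 1) a : ℂ) * (G k (J : ℝ) - G k 0)‖
      ≤ 2 * ∫ x in (0 : ℝ)..J, ‖G (N + 1) x‖ := by
    intro J
    have e1 : ∑ j ∈ Finset.range J, ∫ x in ((j : ℕ) : ℝ)..(j + 1 : ℕ), G 0 x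
        = ∫ x in (0 : ℝ)..J, G 0 x := by
      have := intervalIntegral.sum_integral_adjacent_intervals (f := G 0) (μ := volume)
        (a := fun j : ℕ => (j : ℝ)) (n := J)
        (fun k _ => hint 0 _ _ (Nat.cast_nonneg _) (Nat.cast_nonneg _))
      simpa using this
    have e2 : ∑ j ∈ Finset.range J, ∫ x in ((j : ℕ) : ℝ)..(j + 1 : ℕ), ‖G (N + 1) x‖
        = ∫ x in (0 : ℝ)..J, ‖G (N + 1) x‖ := by
      have := intervalIntegral.sum_integral_adjacent_intervals (f := fun x => ‖G (N + 1) x‖)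
        (μ := volume) (a := fun j : ℕ => (j : ℝ)) (n := J)
        (fun k _ => (hint (N + 1) _ _ (Nat.cast_nonneg _) (Nat.cast_nonneg _)).norm)
      simpa using this
    have e3 : ∑ j ∈ Finset.range J, ∑ k ∈ Finset.range (N + 1),
        (bernNorm (k + 1) a : ℂ) * (G k ((j + 1 : ℕ) : ℝ) - G k j)
        = ∑ k ∈ Finset.range (N + 1), (bernNorm (k + 1) a : ℂ) * (G k (J : ℝ) - G k 0) := by
      rw [Finset.sum_comm]
      refine Finset.sum_congr rfl fun k _ => ?_
      rw [← Finset.mul_sum, Finset.sum_range_sub (fun j : ℕ => G k (j : ℝ))]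
      simp
    rw [← e1, ← e3, ← e2, ← Finset.sum_sub_distrib, ← Finset.sum_sub_distrib, Finset.mul_sum]
    exact (norm_sum_le _ _).trans (Finset.sum_le_sum fun j _ => hloc j)
  have hbound : ∀ J : ℕ, 2 * ∫ x in (0 : ℝ)..J, ‖G (N + 1) x‖ ≤ 2 * C / c := by
    intro J
    have h1 : ∫ x in (0 : ℝ)..J, ‖G (N + 1) x‖ ≤ ∫ x in (0 : ℝ)..J, C * Real.exp (-(c * x)) := by
      apply intervalIntegral.integral_mono_on (Nat.cast_nonneg J)
      · exact (hint _ _ _ le_rfl (Nat.cast_nonneg J)).norm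
      · exact Continuous.intervalIntegrable (by fun_prop) _ _
      · intro x hx; exact hC x hx.1
    have h2 : ∫ x in (0 : ℝ)..J, C * Real.exp (-(c * x)) = C / c * (1 - Real.exp (-(c * J))) := by
      have : ∀ x ∈ uIcc (0 : ℝ) J, HasDerivAt (fun x => -(C / c) * Real.exp (-(c * x)))
          (C * Real.exp (-(c * x))) x := by
        intro x _
        have h := (((hasDerivAt_id x).const_mul c).neg.exp).const_mul (-(C / c))
        refine h.congr_deriv ?_
        simp only [id, mul_one, Pi.neg_apply]
        field_simp
      rw [intervalIntegral.integral_eq_sub_of_hasDerivAt this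
        (Continuous.intervalIntegrable (by fun_prop) _ _)]
      simp
      ring
    have h3 : C / c * (1 - Real.exp (-(c * J))) ≤ C / c * 1 := by
      gcongr
      linarith [Real.exp_pos (-(c * J))]
    have : 2 * C / c = 2 * (C / c * 1) := by ring
    rw [this]
    linarith
  have hT : Tendsto (fun J : ℕ => ‖(∑ j ∈ Finset.range J, G 0 (j + a))
      - (∫ x in (0 : ℝ)..J, G 0 x)
      - ∑ k ∈ Finset.range (N + 1), (bernNorm (k + 1) a : ℂ) * (G k (J : ℝ) - G k 0)‖) atTop
      (𝓝 ‖S - I - ∑ k ∈ Finset.range (N + 1), (bernNorm (k + 1) a : ℂ) * (0 - G k 0)‖) := by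
    refine ((hS.sub hI).sub (tendsto_finsetSum _ fun k _ => ?_)).norm
    exact (((hlim k).comp tendsto_natCast_atTop_atTop).sub_const _).const_mul _
  have e : S - I + ∑ k ∈ Finset.range (N + 1), (bernNorm (k + 1) a : ℂ) * G k 0
      = S - I - ∑ k ∈ Finset.range (N + 1), (bernNorm (k + 1) a : ℂ) * (0 - G k 0) := by
    simp [Finset.sum_neg_distrib]
  rw [e]
  exact le_of_tendsto' hT fun J => (hsum J).trans (hbound J)

end

end DistinctParts

namespace DistinctParts

noncomputable section

open Filter Topology MeasureTheory Set

/-! ### The functions `1 / (e ^ w + 1)` and `log (1 + e ^ (-w))` along a ray -/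

/-- The function `w ↦ 1 / (e ^ w + 1)`. -/
def fermi (w : ℂ) : ℂ := 1 / (Complex.exp w + 1)

/-- The function `w ↦ log (1 + e ^ (-w))`, a primitive of `-fermi`. -/
def logOneAddExp (w : ℂ) : ℂ := Complex.log (1 + Complex.exp (-w))

open Polynomial in
/-- The polynomials expressing the derivatives of `fermi` in terms of `fermi`. -/
def fermiPoly : ℕ → ℂ[X]
  | 0 => X
  | k + 1 => derivative (fermiPoly k) * (X ^ 2 - X)

lemma one_add_exp_neg_mem_slitPlane {w : ℂ} (hw : 0 < w.re ∨ w = 0) :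
    1 + Complex.exp (-w) ∈ Complex.slitPlane := by
  rcases hw with hw | rfl
  · left
    have h1 : ‖Complex.exp (-w)‖ < 1 := by
      rw [Complex.norm_exp, Complex.neg_re, Real.exp_lt_one_iff]; linarith
    have h2 := (abs_le.1 (Complex.abs_re_le_norm (Complex.exp (-w)))).1
    simp only [Complex.add_re, Complex.one_re]
    linarith
  · left; norm_num

lemma exp_add_one_ne_zero {w : ℂ} (hw : 0 < w.re ∨ w = 0) : Complex.exp w + 1 ≠ 0 := by
  have h := Complex.slitPlane_ne_zero (one_add_exp_neg_mem_slitPlane hw)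
  have e : Complex.exp w + 1 = Complex.exp w * (1 + Complex.exp (-w)) := by
    rw [mul_add, ← Complex.exp_add]; simp
  rw [e]
  exact mul_ne_zero (Complex.exp_ne_zero _) h

lemma fermi_eq (w : ℂ) : fermi w = Complex.exp (-w) / (1 + Complex.exp (-w)) := by
  have e : Complex.exp w + 1 = Complex.exp w * (1 + Complex.exp (-w)) := by
    rw [mul_add, ← Complex.exp_add]; simp
  rw [fermi, e, Complex.exp_neg, one_div, mul_inv, div_eq_mul_inv]

lemma hasDerivAt_fermi {w : ℂ} (hw : 0 < w.re ∨ w = 0) :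
    HasDerivAt fermi (fermi w ^ 2 - fermi w) w := by
  have hne := exp_add_one_ne_zero hw
  have h := ((Complex.hasDerivAt_exp w).add_const 1).inv hne
  have e : fermi = (fun x => Complex.exp x + 1)⁻¹ := by
    ext x; simp [fermi]
  rw [e]
  refine h.congr_deriv ?_
  simp only [Pi.inv_apply]
  field_simp
  ring

lemma hasDerivAt_logOneAddExp {w : ℂ} (hw : 0 < w.re ∨ w = 0) :
    HasDerivAt logOneAddExp (-fermi w) w := by
  have h := (((hasDerivAt_neg w).cexp).const_add 1).clog (one_add_exp_neg_mem_slitPlane hw)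
  refine h.congr_deriv ?_
  rw [fermi_eq]
  ring

lemma hasDerivAt_fermiPoly (k : ℕ) {w : ℂ} (hw : 0 < w.re ∨ w = 0) :
    HasDerivAt (fun w => (fermiPoly k).eval (fermi w)) ((fermiPoly (k + 1)).eval (fermi w)) w := by
  have h := ((fermiPoly k).hasDerivAt (fermi w)).comp w (hasDerivAt_fermi hw)
  refine h.congr_deriv ?_
  simp [fermiPoly]

lemma fermiPoly_eval_zero (k : ℕ) : (fermiPoly k).eval 0 = 0 := by
  cases k <;> simp [fermiPoly]

section explicit

open Polynomial

lemma fermiPoly_one : fermiPoly 1 = X ^ 2 - X := by simp [fermiPoly]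

lemma fermiPoly_two : fermiPoly 2 = 2 * X ^ 3 - 3 * X ^ 2 + X := by
  rw [fermiPoly, fermiPoly_one]; simp; ring

lemma fermiPoly_three : fermiPoly 3 = 6 * X ^ 4 - 12 * X ^ 3 + 7 * X ^ 2 - X := by
  rw [fermiPoly, fermiPoly_two]; simp; simp only [map_ofNat C]; ring

lemma fermiPoly_four :
    fermiPoly 4 = 24 * X ^ 5 - 60 * X ^ 4 + 50 * X ^ 3 - 15 * X ^ 2 + X := by
  rw [fermiPoly, fermiPoly_three]; simp; simp only [map_ofNat C]; ring

lemma fermiPoly_five :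
    fermiPoly 5 = 120 * X ^ 6 - 360 * X ^ 5 + 390 * X ^ 4 - 180 * X ^ 3 + 31 * X ^ 2 - X := by
  rw [fermiPoly, fermiPoly_four]; simp; simp only [map_ofNat C]; ring

lemma fermiPoly_six :
    fermiPoly 6 = 720 * X ^ 7 - 2520 * X ^ 6 + 3360 * X ^ 5 - 2100 * X ^ 4 + 602 * X ^ 3
      - 63 * X ^ 2 + X := by
  rw [fermiPoly, fermiPoly_five]; simp; simp only [map_ofNat C]; ring

end explicit

/-- The constant is an upper bound for the sum of `|c_k| (11 / 10) ^ (k - 1)` over the coefficients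
`c_k` of `fermiPoly 6`. -/
lemma norm_fermiPoly_six_le {v : ℂ} (hv : ‖v‖ ≤ 11 / 10) :
    ‖(fermiPoly 6).eval v‖ ≤ 13900 * ‖v‖ := by
  have hx := norm_nonneg v
  rw [fermiPoly_six]
  simp only [Polynomial.eval_add, Polynomial.eval_sub, Polynomial.eval_mul, Polynomial.eval_pow,
    Polynomial.eval_X, Polynomial.eval_ofNat]
  have e : (720 * v ^ 7 - 2520 * v ^ 6 + 3360 * v ^ 5 - 2100 * v ^ 4 + 602 * v ^ 3
      - 63 * v ^ 2 + v) = (720 * v ^ 6 - 2520 * v ^ 5 + 3360 * v ^ 4 - 2100 * v ^ 3 + 602 * v ^ 2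
      - 63 * v + 1) * v := by ring
  rw [e, norm_mul]
  refine mul_le_mul_of_nonneg_right ?_ hx
  have h1 : ‖720 * v ^ 6 - 2520 * v ^ 5 + 3360 * v ^ 4 - 2100 * v ^ 3 + 602 * v ^ 2
      - 63 * v + 1‖ ≤ 720 * ‖v‖ ^ 6 + 2520 * ‖v‖ ^ 5 + 3360 * ‖v‖ ^ 4 + 2100 * ‖v‖ ^ 3
      + 602 * ‖v‖ ^ 2 + 63 * ‖v‖ + 1 := by
    refine (norm_add_le _ _).trans (add_le_add ?_ (by simp))
    refine (norm_sub_le _ _).trans (add_le_add ?_ (by simp))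
    refine (norm_add_le _ _).trans (add_le_add ?_ (by simp))
    refine (norm_sub_le _ _).trans (add_le_add ?_ (by simp))
    refine (norm_add_le _ _).trans (add_le_add ?_ (by simp))
    refine (norm_sub_le _ _).trans (add_le_add ?_ (by simp))
    simp
  refine h1.trans ?_
  have hp : ∀ k : ℕ, ‖v‖ ^ k ≤ (11 / 10) ^ k := fun k => pow_le_pow_left₀ hx hv k
  have := hp 6; have := hp 5; have := hp 4; have := hp 3; have := hp 2
  norm_num at *
  linarith

lemma norm_le_norm_one_add_of_re_nonneg {u : ℂ} (hu : 0 ≤ u.re) : ‖u‖ ≤ ‖u + 1‖ := by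
  rw [Complex.norm_def, Complex.norm_def]
  apply Real.sqrt_le_sqrt
  simp only [Complex.normSq_apply, Complex.add_re, Complex.add_im, Complex.one_re, Complex.one_im]
  nlinarith

/-- In the sector `|Im w| ≤ Re w / 2` the function `fermi` stays away from its poles `± π i`. -/
lemma norm_fermi_le_of_sector {w : ℂ} (hw' : |w.im| ≤ w.re / 2) :
    ‖fermi w‖ ≤ 11 / 10 * Real.exp (-w.re) := by
  have hexp : 0 < Real.exp w.re := Real.exp_pos _
  suffices h : 10 / 11 * Real.exp w.re ≤ ‖Complex.exp w + 1‖ by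
    rw [fermi, norm_div, norm_one, Real.exp_neg, div_le_iff₀ (lt_of_lt_of_le (by positivity) h)]
    calc (1 : ℝ) = 11 / 10 * (Real.exp w.re)⁻¹ * (10 / 11 * Real.exp w.re) := by
          field_simp
      _ ≤ _ := by gcongr
  by_cases h : |w.im| ≤ Real.pi / 2
  · have h1 : 0 ≤ (Complex.exp w).re := by
      rw [Complex.exp_re]
      exact mul_nonneg hexp.le (Real.cos_nonneg_of_mem_Icc (abs_le.1 h))
    have h2 := norm_le_norm_one_add_of_re_nonneg h1
    rw [Complex.norm_exp] at h2
    linarith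
  · push Not at h
    have hs : 3 ≤ w.re := by linarith [Real.pi_gt_three]
    have h1 : (11 : ℝ) ≤ Real.exp w.re := by
      have h3 : (2.7 : ℝ) ^ 3 ≤ Real.exp 3 := by
        have := Real.exp_one_gt_d9
        calc (2.7 : ℝ) ^ 3 ≤ Real.exp 1 ^ 3 := by gcongr; linarith
          _ = Real.exp 3 := by rw [← Real.exp_nat_mul]; norm_num
      have := Real.exp_le_exp.2 hs
      norm_num at h3
      linarith
    have h2 : ‖Complex.exp w‖ - ‖(-1 : ℂ)‖ ≤ ‖Complex.exp w - (-1)‖ := norm_sub_norm_le _ _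
    rw [Complex.norm_exp, norm_neg, norm_one, sub_neg_eq_add] at h2
    linarith

lemma norm_fermi_le {w : ℂ} (hw : 0 < w.re) :
    ‖fermi w‖ ≤ Real.exp (-w.re) / (1 - Real.exp (-w.re)) := by
  have h0 : Real.exp (-w.re) < 1 := by rw [Real.exp_lt_one_iff]; linarith
  rw [fermi_eq, norm_div, Complex.norm_exp, Complex.neg_re]
  have h2 : ‖(1 : ℂ)‖ - ‖-Complex.exp (-w)‖ ≤ ‖1 - -Complex.exp (-w)‖ := norm_sub_norm_le _ _
  rw [norm_neg, Complex.norm_exp, Complex.neg_re, norm_one, sub_neg_eq_add] at h2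
  have : 0 < 1 - Real.exp (-w.re) := by linarith
  gcongr

lemma norm_log_one_add_le_div {x : ℂ} (hx : ‖x‖ < 1) :
    ‖Complex.log (1 + x)‖ ≤ ‖x‖ / (1 - ‖x‖) := by
  refine (Complex.norm_log_one_add_le hx).trans ?_
  have h1 : 0 < 1 - ‖x‖ := by linarith
  rw [← div_eq_mul_inv, le_div_iff₀ h1]
  have : (‖x‖ ^ 2 / (1 - ‖x‖) / 2 + ‖x‖) * (1 - ‖x‖) = ‖x‖ ^ 2 / 2 + ‖x‖ * (1 - ‖x‖) := by
    field_simp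
  rw [this]
  nlinarith [sq_nonneg ‖x‖]

lemma norm_logOneAddExp_le {w : ℂ} (hw : 0 < w.re) :
    ‖logOneAddExp w‖ ≤ Real.exp (-w.re) / (1 - Real.exp (-w.re)) := by
  have h := norm_log_one_add_le_div (x := Complex.exp (-w)) (by
    rw [Complex.norm_exp, Complex.neg_re, Real.exp_lt_one_iff]; linarith)
  rwa [Complex.norm_exp, Complex.neg_re] at h

section ray

variable {z : ℂ}

lemma re_pos_or_eq_zero_of_ray (hz : 0 < z.re) {x : ℝ} (hx : 0 ≤ x) :
    0 < ((x : ℂ) * z).re ∨ (x : ℂ) * z = 0 := by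
  rcases hx.eq_or_lt with h | h
  · right; simp [← h]
  · left; simp [h, hz]

lemma hasDerivAt_ofReal_mul (z : ℂ) (x : ℝ) : HasDerivAt (fun x : ℝ => (x : ℂ) * z) z x := by
  simpa using (HasDerivAt.ofReal_comp (hasDerivAt_id x)).mul_const z

lemma tendsto_exp_neg_ray (hz : 0 < z.re) :
    Tendsto (fun x : ℝ => Complex.exp (-((x : ℂ) * z))) atTop (𝓝 0) := by
  rw [tendsto_zero_iff_norm_tendsto_zero]
  simp only [Complex.norm_exp, Complex.neg_re, Complex.re_ofReal_mul]
  exact Real.tendsto_exp_neg_atTop_nhds_zero.comp (tendsto_id.atTop_mul_const hz)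

lemma tendsto_fermi_ray (hz : 0 < z.re) :
    Tendsto (fun x : ℝ => fermi ((x : ℂ) * z)) atTop (𝓝 0) := by
  have h := tendsto_exp_neg_ray hz
  have h2 := h.div (h.const_add 1) (by simp)
  simp only [zero_div] at h2
  refine h2.congr fun x => ?_
  rw [fermi_eq]; rfl

lemma tendsto_logOneAddExp_ray (hz : 0 < z.re) :
    Tendsto (fun x : ℝ => logOneAddExp ((x : ℂ) * z)) atTop (𝓝 0) := by
  have h := ((tendsto_exp_neg_ray hz).const_add 1).clog (by simp)
  rw [add_zero, Complex.log_one] at h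
  exact h

lemma tendsto_fermiPoly_ray (hz : 0 < z.re) (k : ℕ) :
    Tendsto (fun x : ℝ => (fermiPoly k).eval (fermi ((x : ℂ) * z))) atTop (𝓝 0) := by
  have h := ((fermiPoly k).continuous.tendsto 0).comp (tendsto_fermi_ray hz)
  rw [fermiPoly_eval_zero] at h
  exact h

lemma norm_fermiPoly_six_ray_le (hz : 0 < z.re) (hz' : |z.im| ≤ z.re / 2) {x : ℝ} (hx : 0 ≤ x) :
    ‖(fermiPoly 6).eval (fermi ((x : ℂ) * z))‖ ≤ 15300 * Real.exp (-(z.re * x)) := by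
  have h := norm_fermi_le_of_sector (w := (x : ℂ) * z) (by
    simp only [Complex.re_ofReal_mul, Complex.im_ofReal_mul, abs_mul, abs_of_nonneg hx]
    nlinarith)
  rw [Complex.re_ofReal_mul, mul_comm x] at h
  have h1 : Real.exp (-(z.re * x)) ≤ 1 := by
    rw [Real.exp_le_one_iff]; nlinarith [mul_nonneg hz.le hx]
  refine (norm_fermiPoly_six_le (by linarith)).trans ?_
  have := Real.exp_pos (-(z.re * x))
  linarith

/-- The chain of derivatives of `x ↦ fermi (x z)`. -/
def fermiChain (z : ℂ) (k : ℕ) (x : ℝ) : ℂ := z ^ k * (fermiPoly k).eval (fermi ((x : ℂ) * z))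

/-- The chain of derivatives of `x ↦ log (1 + e ^ (-x z))`. -/
def logChain (z : ℂ) : ℕ → ℝ → ℂ
  | 0, x => logOneAddExp ((x : ℂ) * z)
  | k + 1, x => -(z * fermiChain z k x)

lemma hasDerivAt_fermiChain (hz : 0 < z.re) (k : ℕ) {x : ℝ} (hx : 0 ≤ x) :
    HasDerivAt (fermiChain z k) (fermiChain z (k + 1) x) x := by
  have h := ((hasDerivAt_fermiPoly k (re_pos_or_eq_zero_of_ray hz hx)).comp x
    (hasDerivAt_ofReal_mul z x)).const_mul (z ^ k)
  refine h.congr_deriv ?_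
  simp only [fermiChain]
  ring

lemma hasDerivAt_logChain (hz : 0 < z.re) (k : ℕ) {x : ℝ} (hx : 0 ≤ x) :
    HasDerivAt (logChain z k) (logChain z (k + 1) x) x := by
  cases k with
  | zero =>
    have h := (hasDerivAt_logOneAddExp (re_pos_or_eq_zero_of_ray hz hx)).comp x
      (hasDerivAt_ofReal_mul z x)
    refine h.congr_deriv ?_
    simp [logChain, fermiChain, fermiPoly, mul_comm]
  | succ k => exact ((hasDerivAt_fermiChain hz k hx).const_mul z).neg

lemma tendsto_fermiChain (hz : 0 < z.re) (k : ℕ) : Tendsto (fermiChain z k) atTop (𝓝 0) := by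
  have h := (tendsto_fermiPoly_ray hz k).const_mul (z ^ k)
  rw [mul_zero] at h
  exact h

lemma tendsto_logChain (hz : 0 < z.re) (k : ℕ) : Tendsto (logChain z k) atTop (𝓝 0) := by
  cases k with
  | zero => exact tendsto_logOneAddExp_ray hz
  | succ k =>
    have h := ((tendsto_fermiChain hz k).const_mul z).neg
    rw [mul_zero, neg_zero] at h
    exact h

lemma tendsto_integral_fermiChain (hz : 0 < z.re) :
    Tendsto (fun J : ℕ => ∫ x in (0 : ℝ)..J, fermiChain z 0 x) atTop
      (𝓝 ((Real.log 2 : ℝ) / z)) := by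
  have hz0 : z ≠ 0 := by rintro rfl; simp at hz
  have h1 : ∀ J : ℕ, ∫ x in (0 : ℝ)..J, fermiChain z 0 x
      = ((Real.log 2 : ℝ) - logOneAddExp ((J : ℝ) * z)) / z := by
    intro J
    have hd : ∀ x ∈ uIcc (0 : ℝ) J, HasDerivAt (fun x => -(logChain z 0 x / z))
        (fermiChain z 0 x) x := by
      intro x hx
      rw [uIcc_of_le (Nat.cast_nonneg J)] at hx
      refine ((hasDerivAt_logChain hz 0 hx.1).div_const z).neg.congr_deriv ?_
      simp only [logChain]
      field_simp
    rw [intervalIntegral.integral_eq_sub_of_hasDerivAt hd]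
    · have e : logChain z 0 0 = (Real.log 2 : ℝ) := by
        simp [logChain, logOneAddExp, one_add_one_eq_two]
      rw [e]
      simp only [logChain]
      ring
    · apply ContinuousOn.intervalIntegrable
      intro x hx
      rw [uIcc_of_le (Nat.cast_nonneg J)] at hx
      exact (hasDerivAt_fermiChain hz 0 hx.1).continuousAt.continuousWithinAt
  simp only [h1]
  have h2 := (((tendsto_logOneAddExp_ray hz).comp tendsto_natCast_atTop_atTop).const_sub
    ((Real.log 2 : ℝ) : ℂ)).div_const z
  simpa using h2

lemma hasSum_neg_one_pow_div_sq :
    HasSum (fun k : ℕ => (-1 : ℝ) ^ k / ((k : ℝ) + 1) ^ 2) (Real.pi ^ 2 / 12) := by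
  have h := hasSum_one_div_nat_pow_mul_cos (k := 1) one_ne_zero (x := 1 / 2) (by norm_num)
  have e : ∀ n : ℕ, Real.cos (2 * Real.pi * n * (1 / 2)) = (-1) ^ n := by
    intro n; rw [← Real.cos_nat_mul_pi]; ring_nf
  simp only [e] at h
  have h2 := ((hasSum_nat_add_iff' 1).2 h).neg
  have hv := bernoulliFun_two (1 / 2)
  simp only [bernoulliFun] at hv
  simp only [mul_one, hv] at h2
  have hterm : ∀ k : ℕ, -(1 / ((k + 1 : ℕ) : ℝ) ^ 2 * (-1) ^ (k + 1))
      = (-1 : ℝ) ^ k / ((k : ℝ) + 1) ^ 2 := by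
    intro k
    push_cast
    rw [pow_succ (-1 : ℝ) k]; ring
  simp only [hterm] at h2
  have hval : -((-1 : ℝ) ^ (1 + 1) * (2 * Real.pi) ^ 2 / 2 / (Nat.factorial 2 : ℝ) *
      ((1 / 2) ^ 2 - 1 / 2 + 6⁻¹) - ∑ x ∈ Finset.range 1, 1 / (x : ℝ) ^ 2 * (-1) ^ x)
      = Real.pi ^ 2 / 12 := by
    norm_num [Nat.factorial]
    ring
  rwa [hval] at h2

lemma integral_exp_neg_mul_Ioi {z : ℂ} (hz : 0 < z.re) (k : ℕ) :
    ∫ x in Ioi (0 : ℝ), Complex.exp (-(((k : ℂ) + 1) * (x * z))) = 1 / (((k : ℂ) + 1) * z) := by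
  have hk : (0 : ℝ) < (k : ℝ) + 1 := by positivity
  have h := integral_exp_mul_complex_Ioi (a := -(((k : ℂ) + 1) * z)) (by
    have : ((k : ℂ) + 1) * z = (((k : ℝ) + 1 : ℝ) : ℂ) * z := by push_cast; ring
    rw [this, Complex.neg_re, Complex.re_ofReal_mul]
    nlinarith [mul_pos hk hz]) 0
  have e : ∀ x : ℝ, -(((k : ℂ) + 1) * z) * x = -(((k : ℂ) + 1) * (x * z)) := by intro x; ring
  simp only [e] at h
  rw [h]
  simp

lemma integrableOn_logOneAddExp_ray (hz : 0 < z.re) :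
    IntegrableOn (fun x : ℝ => logOneAddExp ((x : ℂ) * z)) (Ioi 0) := by
  have hc : ContinuousOn (fun x : ℝ => logOneAddExp ((x : ℂ) * z)) (Ici 0) := fun x hx =>
    (hasDerivAt_logChain hz 0 hx).continuousAt.continuousWithinAt
  have hO : (fun x : ℝ => logOneAddExp ((x : ℂ) * z)) =O[atTop]
      fun x => Real.exp (-z.re * x) := by
    refine Asymptotics.IsBigO.of_bound (3 / 2) ?_
    have h1 : ∀ᶠ x : ℝ in atTop, ‖Complex.exp (-((x : ℂ) * z))‖ ≤ 1 / 2 := by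
      have := (tendsto_zero_iff_norm_tendsto_zero.1 (tendsto_exp_neg_ray hz))
      exact (this.eventually_lt_const (by norm_num : (0 : ℝ) < 1 / 2)).mono fun _ h => h.le
    filter_upwards [h1] with x hx
    have h2 := Complex.norm_log_one_add_half_le_self hx
    rw [Complex.norm_exp, Complex.neg_re, Complex.re_ofReal_mul] at h2
    rw [Real.norm_of_nonneg (Real.exp_pos _).le, neg_mul, mul_comm z.re x]
    exact h2
  exact (integrableOn_Ici_iff_integrableOn_Ioi (by finiteness)).1 <|
    (hc.locallyIntegrableOn measurableSet_Ici).integrableOn_of_isBigO_atTop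
      hO ⟨Ioi z.re, Ioi_mem_atTop z.re, exp_neg_integrableOn_Ioi z.re hz⟩

lemma integral_logOneAddExp_ray (hz : 0 < z.re) :
    ∫ x in Ioi (0 : ℝ), logOneAddExp ((x : ℂ) * z) = (Real.pi : ℂ) ^ 2 / (12 * z) := by
  have hz0 : z ≠ 0 := by rintro rfl; simp at hz
  set F : ℕ → ℝ → ℂ := fun k x =>
    (-1 : ℂ) ^ k / ((k : ℂ) + 1) * Complex.exp (-(((k : ℂ) + 1) * (x * z))) with hF
  have hk : ∀ k : ℕ, (0 : ℝ) < (k : ℝ) + 1 := fun k => by positivity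
  have hnorm : ∀ k x, ‖F k x‖ = 1 / ((k : ℝ) + 1) * Real.exp (-(((k : ℝ) + 1) * z.re) * x) := by
    intro k x
    have e1 : ((k : ℂ) + 1) * (x * z) = ((((k : ℝ) + 1) * x : ℝ) : ℂ) * z := by push_cast; ring
    have e2 : ‖((k : ℂ) + 1)‖ = (k : ℝ) + 1 := by
      rw [← Nat.cast_succ, Complex.norm_natCast]; push_cast; ring
    simp only [hF]
    rw [norm_mul, norm_div, norm_pow, norm_neg, norm_one, one_pow, e2, e1, Complex.norm_exp,
      Complex.neg_re, Complex.re_ofReal_mul]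
    congr 2
    ring
  have hInt : ∀ k, Integrable (F k) (volume.restrict (Ioi 0)) := by
    intro k
    rw [← integrable_norm_iff]
    · simp only [hnorm]
      exact (integrableOn_exp_mul_Ioi (by nlinarith [mul_pos (hk k) hz]) 0).const_mul _
    · exact Continuous.aestronglyMeasurable (by fun_prop)
  have hIv : ∀ k, ∫ x in Ioi (0 : ℝ), ‖F k x‖ = 1 / z.re * (1 / (((k + 1 : ℕ) : ℝ)) ^ 2) := by
    intro k
    simp only [hnorm]
    rw [integral_const_mul, integral_exp_mul_Ioi (by nlinarith [mul_pos (hk k) hz])]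
    have := hk k
    push_cast
    simp
    field_simp
  have hsum : Summable fun k => ∫ x in Ioi (0 : ℝ), ‖F k x‖ := by
    simp only [hIv]
    exact ((summable_nat_add_iff 1).2
      (Real.summable_one_div_nat_pow.2 one_lt_two)).mul_left _
  have h1 := hasSum_integral_of_summable_integral_norm hInt hsum
  have h2 : ∫ x in Ioi (0 : ℝ), ∑' k, F k x = ∫ x in Ioi (0 : ℝ), logOneAddExp ((x : ℂ) * z) := by
    refine setIntegral_congr_fun measurableSet_Ioi fun x hx => ?_
    have hx' : (0 : ℝ) < x := hx
    have hlt : ‖-Complex.exp (-((x : ℂ) * z))‖ < 1 := by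
      rw [norm_neg, Complex.norm_exp, Complex.neg_re, Complex.re_ofReal_mul, Real.exp_lt_one_iff]
      nlinarith [mul_pos hx' hz]
    have h3 := (Complex.hasSum_taylorSeries_neg_log' hlt).neg
    rw [neg_neg, sub_neg_eq_add] at h3
    refine Eq.trans ?_ h3.tsum_eq
    refine tsum_congr fun k => ?_
    simp only [hF]
    have : Complex.exp (-(((k : ℂ) + 1) * (x * z))) = Complex.exp (-((x : ℂ) * z)) ^ (k + 1) := by
      rw [← Complex.exp_nat_mul]; congr 1; push_cast; ring
    rw [this, neg_pow (Complex.exp _) (k + 1), pow_succ (-1 : ℂ) k]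
    ring
  have h4 : ∀ k, ∫ x in Ioi (0 : ℝ), F k x
      = (((-1 : ℝ) ^ k / ((k : ℝ) + 1) ^ 2 : ℝ) : ℂ) / z := by
    intro k
    simp only [hF]
    rw [integral_const_mul, integral_exp_neg_mul_Ioi hz]
    have : (k : ℂ) + 1 ≠ 0 := Nat.cast_add_one_ne_zero k
    push_cast
    field_simp
  rw [h2] at h1
  simp only [h4] at h1
  have h5 := (Complex.hasSum_ofReal.2 hasSum_neg_one_pow_div_sq).div_const z
  rw [h1.unique h5]
  push_cast
  field_simp

lemma tendsto_integral_logChain (hz : 0 < z.re) :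
    Tendsto (fun J : ℕ => ∫ x in (0 : ℝ)..J, logChain z 0 x) atTop
      (𝓝 ((Real.pi : ℂ) ^ 2 / (12 * z))) := by
  rw [← integral_logOneAddExp_ray hz]
  exact intervalIntegral_tendsto_integral_Ioi 0 (integrableOn_logOneAddExp_ray hz)
    tendsto_natCast_atTop_atTop

end ray

end

end DistinctParts

namespace DistinctParts

noncomputable section

open Filter Topology MeasureTheory Set

/-! ### The infinite product, the Lambert series and the formula of Cauchy -/

/-- The logarithm `∑ log (1 + e ^ (-m z))`, `m ≥ 1`, of the generating function of partitions into
distinct parts at `q = e ^ (-z)`. -/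
def logDistinctGen (z : ℂ) : ℂ := ∑' m : ℕ, logOneAddExp (((m + 1 : ℕ) : ℂ) * z)

/-- The Lambert series `∑ q ^ m / (1 + q ^ m)` over `m ≡ r (mod t)`, `m ≥ 1`, at `q = e ^ (-z)`
(for `1 ≤ r ≤ t`). -/
def lambertSum (r t : ℕ) (z : ℂ) : ℂ := ∑' j : ℕ, fermi (((r + j * t : ℕ) : ℂ) * z)

lemma re_natCast_mul (m : ℕ) (z : ℂ) : ((m : ℂ) * z).re = m * z.re := by simp

lemma im_natCast_mul (m : ℕ) (z : ℂ) : ((m : ℂ) * z).im = m * z.im := by simp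

lemma exp_neg_pow_le_div {x : ℝ} (hx : 0 < x) {m : ℕ} (hm : 1 ≤ m) :
    Real.exp (-(m * x)) / (1 - Real.exp (-(m * x)))
      ≤ (1 - Real.exp (-x))⁻¹ * Real.exp (-x) ^ m := by
  have h0 : 0 < 1 - Real.exp (-x) := by
    rw [sub_pos, Real.exp_lt_one_iff]; linarith
  have hm' : (1 : ℝ) ≤ m := by exact_mod_cast hm
  have h1 : Real.exp (-(m * x)) ≤ Real.exp (-x) := by
    apply Real.exp_le_exp.2; nlinarith
  have e : Real.exp (-x) ^ m = Real.exp (-(m * x)) := by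
    rw [← Real.exp_nat_mul]; ring_nf
  rw [e, div_eq_mul_inv, mul_comm]
  gcongr

lemma norm_fermi_nat_mul_le {z : ℂ} (hz : 0 < z.re) {m : ℕ} (hm : 1 ≤ m) :
    ‖fermi ((m : ℂ) * z)‖ ≤ (1 - Real.exp (-z.re))⁻¹ * Real.exp (-z.re) ^ m := by
  have hm' : (0 : ℝ) < m := by exact_mod_cast hm
  have e := re_natCast_mul m z
  have h := norm_fermi_le (w := (m : ℂ) * z) (by rw [e]; positivity)
  rw [e] at h
  exact h.trans (exp_neg_pow_le_div hz hm)

lemma norm_logOneAddExp_nat_mul_le {z : ℂ} (hz : 0 < z.re) {m : ℕ} (hm : 1 ≤ m) :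
    ‖logOneAddExp ((m : ℂ) * z)‖ ≤ (1 - Real.exp (-z.re))⁻¹ * Real.exp (-z.re) ^ m := by
  have hm' : (0 : ℝ) < m := by exact_mod_cast hm
  have e := re_natCast_mul m z
  have h := norm_logOneAddExp_le (w := (m : ℂ) * z) (by rw [e]; positivity)
  rw [e] at h
  exact h.trans (exp_neg_pow_le_div hz hm)

lemma exp_neg_re_mem {x : ℝ} (hx : 0 < x) : 0 < Real.exp (-x) ∧ Real.exp (-x) < 1 :=
  ⟨Real.exp_pos _, by rw [Real.exp_lt_one_iff]; linarith⟩

lemma summable_geometric_bound {x : ℝ} (hx : 0 < x) :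
    Summable fun j : ℕ => (1 - Real.exp (-x))⁻¹ * Real.exp (-x) ^ j :=
  (summable_geometric_of_lt_one (exp_neg_re_mem hx).1.le (exp_neg_re_mem hx).2).mul_left _

lemma norm_fermi_progression_le {z : ℂ} (hz : 0 < z.re) {r t : ℕ} (hr : 1 ≤ r) (ht : 1 ≤ t)
    (j : ℕ) : ‖fermi (((r + j * t : ℕ) : ℂ) * z)‖
      ≤ (1 - Real.exp (-z.re))⁻¹ * Real.exp (-z.re) ^ j := by
  have h0 := exp_neg_re_mem hz
  have hj : j ≤ r + j * t := by nlinarith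
  refine (norm_fermi_nat_mul_le hz (by omega)).trans ?_
  have h1 : 0 ≤ (1 - Real.exp (-z.re))⁻¹ := inv_nonneg.2 (by linarith [h0.2])
  exact mul_le_mul_of_nonneg_left (pow_le_pow_of_le_one h0.1.le h0.2.le hj) h1

lemma norm_logOneAddExp_succ_le {z : ℂ} (hz : 0 < z.re) (m : ℕ) :
    ‖logOneAddExp (((m + 1 : ℕ) : ℂ) * z)‖
      ≤ (1 - Real.exp (-z.re))⁻¹ * Real.exp (-z.re) ^ m := by
  have h0 := exp_neg_re_mem hz
  refine (norm_logOneAddExp_nat_mul_le hz (by omega)).trans ?_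
  have h1 : 0 ≤ (1 - Real.exp (-z.re))⁻¹ := inv_nonneg.2 (by linarith [h0.2])
  exact mul_le_mul_of_nonneg_left (pow_le_pow_of_le_one h0.1.le h0.2.le (by omega)) h1

lemma hasSum_logDistinctGen {z : ℂ} (hz : 0 < z.re) :
    HasSum (fun m : ℕ => logOneAddExp (((m + 1 : ℕ) : ℂ) * z)) (logDistinctGen z) :=
  (Summable.of_norm_bounded (summable_geometric_bound hz) (norm_logOneAddExp_succ_le hz)).hasSum

lemma hasSum_lambertSum {z : ℂ} (hz : 0 < z.re) {r t : ℕ} (hr : 1 ≤ r) (ht : 1 ≤ t) :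
    HasSum (fun j : ℕ => fermi (((r + j * t : ℕ) : ℂ) * z)) (lambertSum r t z) :=
  (Summable.of_norm_bounded (summable_geometric_bound hz)
    (norm_fermi_progression_le hz hr ht)).hasSum

lemma norm_lambertSum_le {z : ℂ} (hz : 0 < z.re) {r t : ℕ} (hr : 1 ≤ r) (ht : 1 ≤ t) :
    ‖lambertSum r t z‖ ≤ ((1 - Real.exp (-z.re))⁻¹) ^ 2 := by
  have h0 := exp_neg_re_mem hz
  have h := (hasSum_geometric_of_lt_one h0.1.le h0.2).mul_left ((1 - Real.exp (-z.re))⁻¹)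
  rw [← sq] at h
  rw [lambertSum]
  exact tsum_of_norm_bounded h (norm_fermi_progression_le hz hr ht)

lemma inv_one_sub_exp_neg_le {x : ℝ} (hx : 0 < x) : (1 - Real.exp (-x))⁻¹ ≤ (1 + x) / x := by
  have h1 : Real.exp (-x) ≤ 1 / (1 + x) := by
    rw [Real.exp_neg, ← one_div]
    exact one_div_le_one_div_of_le (by linarith) (by linarith [Real.add_one_le_exp x])
  rw [inv_le_comm₀ (by linarith [(exp_neg_re_mem hx).2]) (by positivity), inv_div]
  have : x / (1 + x) = 1 - 1 / (1 + x) := by field_simp; ring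
  rw [this]
  linarith

/-- In the sector `|Im z| ≤ Re z / 2` the Lambert series has the size `1 / (t Re z)` of its leading
term. -/
lemma norm_lambertSum_le_of_sector {z : ℂ} (hz : 0 < z.re) (hz' : |z.im| ≤ z.re / 2) {r t : ℕ}
    (ht : 1 ≤ t) :
    ‖lambertSum r t z‖ ≤ 11 / 10 * ((1 + t * z.re) / (t * z.re)) := by
  have ht' : (0 : ℝ) < t := by exact_mod_cast ht
  have hx : 0 < t * z.re := by positivity
  have h0 := exp_neg_re_mem hx
  have h := (hasSum_geometric_of_lt_one h0.1.le h0.2).mul_left (11 / 10)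
  have hle : ‖lambertSum r t z‖ ≤ 11 / 10 * (1 - Real.exp (-(t * z.re)))⁻¹ := by
    rw [lambertSum]
    refine tsum_of_norm_bounded h fun j => ?_
    have h1 := norm_fermi_le_of_sector (w := ((r + j * t : ℕ) : ℂ) * z) (by
      rw [im_natCast_mul, re_natCast_mul, abs_mul, Nat.abs_cast]
      have : (0 : ℝ) ≤ ((r + j * t : ℕ) : ℝ) := Nat.cast_nonneg _
      nlinarith)
    refine h1.trans ?_
    rw [← Real.exp_nat_mul, re_natCast_mul]
    have : -(((r + j * t : ℕ) : ℝ) * z.re) ≤ (j : ℝ) * -(t * z.re) := by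
      push_cast
      have : (0 : ℝ) ≤ r * z.re := by positivity
      nlinarith
    gcongr
  refine hle.trans ?_
  have := inv_one_sub_exp_neg_le hx
  gcongr

lemma continuous_arc (η : ℝ) : Continuous fun y : ℝ => (η : ℂ) + y * Complex.I := by fun_prop

lemma re_arc (η y : ℝ) : ((η : ℂ) + y * Complex.I).re = η := by simp

lemma im_arc (η y : ℝ) : ((η : ℂ) + y * Complex.I).im = y := by simp

lemma continuous_fermi_arc {η : ℝ} (hη : 0 < η) {m : ℕ} (hm : 1 ≤ m) :
    Continuous fun y : ℝ => fermi ((m : ℂ) * ((η : ℂ) + y * Complex.I)) := by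
  refine continuous_iff_continuousAt.2 fun y => ?_
  have hm' : (0 : ℝ) < m := by exact_mod_cast hm
  have h := (hasDerivAt_fermi (w := (m : ℂ) * ((η : ℂ) + y * Complex.I)) (Or.inl (by
    rw [re_natCast_mul, re_arc]; positivity))).continuousAt
  exact ContinuousAt.comp (f := fun y : ℝ => (m : ℂ) * ((η : ℂ) + y * Complex.I)) h
    (by fun_prop)

lemma continuous_logOneAddExp_arc {η : ℝ} (hη : 0 < η) {m : ℕ} (hm : 1 ≤ m) :
    Continuous fun y : ℝ => logOneAddExp ((m : ℂ) * ((η : ℂ) + y * Complex.I)) := by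
  refine continuous_iff_continuousAt.2 fun y => ?_
  have hm' : (0 : ℝ) < m := by exact_mod_cast hm
  have h := (hasDerivAt_logOneAddExp (w := (m : ℂ) * ((η : ℂ) + y * Complex.I)) (Or.inl (by
    rw [re_natCast_mul, re_arc]; positivity))).continuousAt
  exact ContinuousAt.comp (f := fun y : ℝ => (m : ℂ) * ((η : ℂ) + y * Complex.I)) h
    (by fun_prop)

lemma continuous_lambertSum_arc {η : ℝ} (hη : 0 < η) {r t : ℕ} (hr : 1 ≤ r) (ht : 1 ≤ t) :
    Continuous fun y : ℝ => lambertSum r t ((η : ℂ) + y * Complex.I) := by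
  unfold lambertSum
  refine continuous_tsum (fun j => continuous_fermi_arc hη (by omega))
    (summable_geometric_bound hη) fun j y => ?_
  have h := norm_fermi_progression_le (z := (η : ℂ) + y * Complex.I) (by rwa [re_arc]) hr ht j
  rwa [re_arc] at h

lemma continuous_logDistinctGen_arc {η : ℝ} (hη : 0 < η) :
    Continuous fun y : ℝ => logDistinctGen ((η : ℂ) + y * Complex.I) := by
  unfold logDistinctGen
  refine continuous_tsum (fun m => continuous_logOneAddExp_arc hη (by omega))
    (summable_geometric_bound hη) fun j y => ?_
  have h := norm_logOneAddExp_succ_le (z := (η : ℂ) + y * Complex.I) (by rwa [re_arc]) j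
  rwa [re_arc] at h

lemma exp_neg_pow (z : ℂ) (m : ℕ) : Complex.exp (-z) ^ m = Complex.exp (-((m : ℂ) * z)) := by
  rw [← Complex.exp_nat_mul, mul_neg]

lemma prod_eq_exp_sum_log {z : ℂ} (hz : 0 < z.re) (M : ℕ) :
    ∏ m ∈ Finset.Icc 1 M, (1 + Complex.exp (-z) ^ m)
      = Complex.exp (∑ m ∈ Finset.range M, logOneAddExp (((m + 1 : ℕ) : ℂ) * z)) := by
  rw [Complex.exp_sum, Finset.range_eq_Ico, Finset.prod_Ico_add'
    (fun m : ℕ => Complex.exp (logOneAddExp ((m : ℂ) * z))) 0 M 1, zero_add]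
  refine Finset.prod_congr (by ext; simp) fun m hm => ?_
  have hm' : (0 : ℝ) < m := by exact_mod_cast (Finset.mem_Icc.1 hm).1
  rw [logOneAddExp, exp_neg_pow, Complex.exp_log]
  apply one_add_exp_neg_ne_zero
  rw [re_natCast_mul]; positivity

/-- The residue class as an arithmetic progression: this is where `1 ≤ r ≤ t` is used. -/
lemma hasSum_lambertSum_residue {z : ℂ} (hz : 0 < z.re) {r t : ℕ} (hr : 1 ≤ r) (hrt : r ≤ t) :
    HasSum (fun m : ℕ => if 1 ≤ m ∧ m ≡ r [MOD t] then fermi ((m : ℂ) * z) else 0)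
      (lambertSum r t z) := by
  have ht : 1 ≤ t := hr.trans hrt
  have hinj : Function.Injective fun j : ℕ => r + j * t := by
    intro i j h
    have : i * t = j * t := by simpa using h
    exact Nat.eq_of_mul_eq_mul_right ht this
  have h := hasSum_lambertSum hz hr ht
  rw [← hinj.hasSum_iff]
  · refine h.congr_fun fun j => ?_
    have : 1 ≤ r + j * t ∧ r + j * t ≡ r [MOD t] := by
      refine ⟨by omega, ?_⟩
      simp [Nat.ModEq]
    simp only [Function.comp_apply, if_pos this]
  · intro m hm
    rw [if_neg]
    rintro ⟨hm1, hmr⟩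
    apply hm
    have hle : r ≤ m := by
      by_contra hlt
      push Not at hlt
      have hd : t ∣ r - m := (Nat.modEq_iff_dvd' hlt.le).1 hmr
      have := Nat.le_of_dvd (by omega) hd
      omega
    obtain ⟨j, hj⟩ := (Nat.modEq_iff_dvd' hle).1 hmr.symm
    exact ⟨j, by simp only; rw [mul_comm]; omega⟩

lemma sum_residue_eq {z : ℂ} (r t M : ℕ) :
    ∑ m ∈ Finset.Icc 1 M with m ≡ r [MOD t], Complex.exp (-z) ^ m / (1 + Complex.exp (-z) ^ m)
      = ∑ m ∈ Finset.range (M + 1),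
        if 1 ≤ m ∧ m ≡ r [MOD t] then fermi ((m : ℂ) * z) else 0 := by
  rw [← Finset.sum_filter]
  refine Finset.sum_congr ?_ fun m _ => ?_
  · ext m
    simp only [Finset.mem_filter, Finset.mem_Icc, Finset.mem_range]
    constructor
    · rintro ⟨⟨h1, h2⟩, h3⟩; exact ⟨by omega, h1, h3⟩
    · rintro ⟨h1, h2, h3⟩; exact ⟨⟨h2, by omega⟩, h3⟩
  · rw [fermi_eq, exp_neg_pow]

lemma tendsto_genTrunc {z : ℂ} (hz : 0 < z.re) {r t : ℕ} (hr : 1 ≤ r) (hrt : r ≤ t) :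
    Tendsto (fun M : ℕ => genTrunc r t M (Complex.exp (-z))) atTop
      (𝓝 (Complex.exp (logDistinctGen z) * lambertSum r t z)) := by
  unfold genTrunc
  refine Tendsto.mul ?_ ?_
  · simp only [prod_eq_exp_sum_log hz]
    exact (Complex.continuous_exp.tendsto _).comp (hasSum_logDistinctGen hz).tendsto_sum_nat
  · simp only [sum_residue_eq]
    exact (hasSum_lambertSum_residue hz hr hrt).tendsto_sum_nat.comp (tendsto_add_atTop_nat 1)

lemma norm_genTrunc_le {z : ℂ} (hz : 0 < z.re) (r t M : ℕ) :
    ‖genTrunc r t M (Complex.exp (-z))‖ ≤ Real.exp (((1 - Real.exp (-z.re))⁻¹) ^ 2)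
      * ((1 - Real.exp (-z.re))⁻¹) ^ 2 := by
  have h0 := exp_neg_re_mem hz
  have h := (hasSum_geometric_of_lt_one h0.1.le h0.2).mul_left ((1 - Real.exp (-z.re))⁻¹)
  rw [← sq] at h
  have hinv : 0 ≤ (1 - Real.exp (-z.re))⁻¹ := inv_nonneg.2 (by linarith [h0.2])
  have hnn : ∀ i : ℕ, 0 ≤ (1 - Real.exp (-z.re))⁻¹ * Real.exp (-z.re) ^ i := fun i =>
    mul_nonneg hinv (pow_nonneg h0.1.le _)
  unfold genTrunc
  rw [norm_mul]
  refine mul_le_mul ?_ ?_ (norm_nonneg _) (Real.exp_pos _).le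
  · rw [prod_eq_exp_sum_log hz, Complex.norm_exp]
    refine Real.exp_le_exp.2 ((Complex.re_le_norm _).trans ((norm_sum_le _ _).trans ?_))
    refine (Finset.sum_le_sum fun m _ => norm_logOneAddExp_succ_le hz m).trans ?_
    exact sum_le_hasSum _ (fun i _ => hnn i) h
  · rw [sum_residue_eq]
    refine (norm_sum_le _ _).trans ?_
    refine (Finset.sum_le_sum fun m _ => ?_).trans (sum_le_hasSum (Finset.range (M + 1))
      (fun i _ => hnn i) h)
    split_ifs with hm
    · exact norm_fermi_nat_mul_le hz hm.1
    · rw [norm_zero]; exact hnn m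

/-- Cauchy's formula for `D r t n`. -/
theorem integral_eq_D {r t : ℕ} (hr : 1 ≤ r) (hrt : r ≤ t) (n : ℕ) {η : ℝ} (hη : 0 < η) :
    ∫ y in (-Real.pi)..Real.pi,
      Complex.exp (logDistinctGen ((η : ℂ) + y * Complex.I))
        * lambertSum r t ((η : ℂ) + y * Complex.I)
        * Complex.exp (n * ((η : ℂ) + y * Complex.I)) = 2 * (Real.pi : ℂ) * (D r t n : ℂ) := by
  have hre : ∀ y : ℝ, 0 < ((η : ℂ) + y * Complex.I).re := fun y => by rwa [re_arc]
  have hcont : ∀ M : ℕ, Continuous fun y : ℝ =>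
      genTrunc r t M (Complex.exp (-((η : ℂ) + y * Complex.I))) *
        Complex.exp (n * ((η : ℂ) + y * Complex.I)) := by
    intro M
    unfold genTrunc
    refine Continuous.mul (Continuous.mul (by fun_prop) ?_) (by fun_prop)
    refine continuous_finsetSum _ fun m hm => ?_
    refine Continuous.div (by fun_prop) (by fun_prop) fun y => ?_
    rw [exp_neg_pow]
    apply one_add_exp_neg_ne_zero
    have : (0 : ℝ) < m := by exact_mod_cast (Finset.mem_Icc.1 (Finset.mem_filter.1 hm).1).1
    rw [re_natCast_mul, re_arc]; positivity
  have hT := intervalIntegral.tendsto_integral_filter_of_dominated_convergence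
    (a := -Real.pi) (b := Real.pi) (μ := volume) (l := atTop)
    (F := fun (M : ℕ) (y : ℝ) => genTrunc r t M (Complex.exp (-((η : ℂ) + y * Complex.I))) *
        Complex.exp (n * ((η : ℂ) + y * Complex.I)))
    (f := fun y : ℝ => Complex.exp (logDistinctGen ((η : ℂ) + y * Complex.I))
        * lambertSum r t ((η : ℂ) + y * Complex.I)
        * Complex.exp (n * ((η : ℂ) + y * Complex.I)))
    (fun _ => Real.exp (((1 - Real.exp (-η))⁻¹) ^ 2) * ((1 - Real.exp (-η))⁻¹) ^ 2
      * Real.exp (n * η))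
    (Eventually.of_forall fun M => (hcont M).aestronglyMeasurable)
    (Eventually.of_forall fun M => Eventually.of_forall fun y _ => by
      have h := norm_genTrunc_le (hre y) r t M
      rw [re_arc] at h
      rw [norm_mul, Complex.norm_exp, re_natCast_mul, re_arc]
      gcongr)
    intervalIntegrable_const
    (Eventually.of_forall fun y _ => (tendsto_genTrunc (hre y) hr hrt).mul_const _)
  refine tendsto_nhds_unique hT ?_
  refine tendsto_const_nhds.congr' ?_
  filter_upwards [eventually_ge_atTop n] with M hM
  exact (integral_genTrunc r t n hM hη).symm

end

end DistinctParts

namespace DistinctParts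

noncomputable section

open Filter Topology MeasureTheory Set

/-! ### Asymptotic expansions near the positive real axis -/

lemma bernNorm_eq_bern (k : ℕ) (x : ℝ) : bernNorm k x = bern k x / (k.factorial : ℝ) := by
  rw [bernNorm, bernoulliFun, bern, Polynomial.aeval_def, Polynomial.eval_map]

lemma fermi_zero : fermi 0 = 1 / 2 := by
  rw [fermi, Complex.exp_zero]; norm_num

lemma fermiChain_zero_right (z : ℂ) (k : ℕ) :
    fermiChain z k 0 = z ^ k * (fermiPoly k).eval (1 / 2) := by
  rw [fermiChain, Complex.ofReal_zero, zero_mul, fermi_zero]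

lemma fermiPoly_values : (fermiPoly 0).eval (1 / 2 : ℂ) = 1 / 2 ∧
    (fermiPoly 1).eval (1 / 2 : ℂ) = -1 / 4 ∧ (fermiPoly 2).eval (1 / 2 : ℂ) = 0 ∧
    (fermiPoly 3).eval (1 / 2 : ℂ) = 1 / 8 ∧ (fermiPoly 4).eval (1 / 2 : ℂ) = 0 ∧
    (fermiPoly 5).eval (1 / 2 : ℂ) = -1 / 4 := by
  rw [fermiPoly_one, fermiPoly_two, fermiPoly_three, fermiPoly_four, fermiPoly_five]
  simp [fermiPoly]
  norm_num

lemma norm_fermiChain_six_le {z : ℂ} (hz : 0 < z.re) (hz' : |z.im| ≤ z.re / 2) {x : ℝ}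
    (hx : 0 ≤ x) : ‖fermiChain z 6 x‖ ≤ 15300 * ‖z‖ ^ 6 * Real.exp (-(z.re * x)) := by
  have h := norm_fermiPoly_six_ray_le hz hz' hx
  rw [fermiChain, norm_mul, norm_pow]
  calc _ ≤ ‖z‖ ^ 6 * (15300 * Real.exp (-(z.re * x))) := by gcongr
    _ = _ := by ring

/-- The asymptotic expansion of the Lambert series up to the term of order `z ^ 3`. -/
theorem norm_lambertSum_sub_le {z : ℂ} (hz : 0 < z.re) (hz' : |z.im| ≤ z.re / 2) {r t : ℕ}
    (hr : 1 ≤ r) (hrt : r ≤ t) :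
    ‖lambertSum r t z - ((Real.log 2 : ℝ) / (t * z) - 1 / 2 * (bern 1 (r / t) : ℝ)
        + (t * z) / 8 * (bern 2 (r / t) : ℝ) - (t * z) ^ 3 / 192 * (bern 4 (r / t) : ℝ))‖
      ≤ 30600 * ‖t * z‖ ^ 6 / (t * z.re) + 1 / 8 * ‖t * z‖ ^ 5 := by
  have ht : (0 : ℝ) < t := by exact_mod_cast hr.trans hrt
  set w : ℂ := t * z with hw
  have hre : w.re = t * z.re := re_natCast_mul t z
  have him : w.im = t * z.im := im_natCast_mul t z
  have hwp : 0 < w.re := by rw [hre]; positivity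
  have hwi : |w.im| ≤ w.re / 2 := by
    rw [hre, him, abs_mul, Nat.abs_cast]; nlinarith
  have ha : (r / t : ℝ) ∈ Icc (0 : ℝ) 1 :=
    ⟨by positivity, by rw [div_le_one ht]; exact_mod_cast hrt⟩
  have hS : Tendsto (fun J : ℕ => ∑ j ∈ Finset.range J, fermiChain w 0 (j + (r / t : ℝ))) atTop
      (𝓝 (lambertSum r t z)) := by
    refine (hasSum_lambertSum hz hr (hr.trans hrt)).tendsto_sum_nat.congr fun J => ?_
    refine Finset.sum_congr rfl fun j _ => ?_
    have ht' : (t : ℂ) ≠ 0 := by exact_mod_cast ht.ne'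
    simp only [fermiChain, pow_zero, one_mul, fermiPoly, Polynomial.eval_X, hw]
    congr 1
    push_cast
    field_simp
    ring
  have h := norm_sum_sub_integral_add_le (G := fermiChain w)
    (fun k x hx => hasDerivAt_fermiChain hwp k hx) 5 (C := 15300 * ‖w‖ ^ 6) hwp
    (fun x hx => norm_fermiChain_six_le hwp hwi hx) (tendsto_fermiChain hwp) ha
    (tendsto_integral_fermiChain hwp) hS
  obtain ⟨p0, p1, p2, p3, p4, p5⟩ := fermiPoly_values
  simp only [Finset.sum_range_succ, Finset.range_zero, Finset.sum_empty, zero_add,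
    fermiChain_zero_right, p0, p1, p2, p3, p4, p5] at h
  generalize ((Real.log 2 : ℝ) : ℂ) = l at h ⊢
  norm_num only [Nat.reduceAdd] at h
  have b6 := abs_bernNorm_le 5 ha
  norm_num only [Nat.reduceAdd] at b6
  set b := bernNorm 6 (r / t) with hb
  have hb' : ‖(b : ℂ) * (w ^ 5 * (1 / 4))‖ ≤ 1 / 8 * ‖w‖ ^ 5 := by
    rw [norm_mul, norm_mul, norm_pow, Complex.norm_real, Real.norm_eq_abs]
    norm_num
    have := norm_nonneg w
    have : 0 ≤ ‖w‖ ^ 5 := by positivity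
    nlinarith
  rw [bernNorm_eq_bern 1, bernNorm_eq_bern 2, bernNorm_eq_bern 4] at h
  norm_num [Nat.factorial] at h
  have e : lambertSum r t z - (l / w - 1 / 2 * (bern 1 (r / t) : ℝ)
        + w / 8 * (bern 2 (r / t) : ℝ) - w ^ 3 / 192 * (bern 4 (r / t) : ℝ))
      = (lambertSum r t z - l / w + ((bern 1 (r / t) : ℂ) * (1 / 2)
        + (bern 2 (r / t) : ℂ) / 2 * (w * (-1 / 4)) + (bern 4 (r / t) : ℂ) / 24 * (w ^ 3 * (1 / 8))
        + (b : ℂ) * (w ^ 5 * (-1 / 4)))) + (b : ℂ) * (w ^ 5 * (1 / 4)) := by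
    ring
  rw [e, ← hre]
  refine (norm_add_le _ _).trans (add_le_add ?_ hb')
  refine le_trans (le_of_eq ?_) (h.trans (le_of_eq ?_))
  · congr 1
    ring
  · ring

lemma bernNorm_eval_one {k : ℕ} (hk : k ≠ 1) :
    bernNorm k 1 = ((bernoulli k : ℚ) : ℝ) / (k.factorial : ℝ) := by
  rw [bernNorm, bernoulliFun_endpoints_eq_of_ne_one hk, bernoulliFun_eval_zero]

/-- The asymptotic expansion of the logarithm of the generating function of partitions into distinct
parts. It terminates: all odd derivatives of `log (1 + e ^ (-x))` of order at least three vanish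
at `0`. -/
theorem norm_logDistinctGen_sub_le {z : ℂ} (hz : 0 < z.re) (hz' : |z.im| ≤ z.re / 2) :
    ‖logDistinctGen z - ((Real.pi : ℂ) ^ 2 / (12 * z) - 1 / 2 * (Real.log 2 : ℝ) + z / 24)‖
      ≤ 30600 * ‖z‖ ^ 7 / z.re := by
  have hS : Tendsto (fun J : ℕ => ∑ j ∈ Finset.range J, logChain z 0 (j + (1 : ℝ))) atTop
      (𝓝 (logDistinctGen z)) := by
    refine (hasSum_logDistinctGen hz).tendsto_sum_nat.congr fun J => ?_
    refine Finset.sum_congr rfl fun j _ => ?_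
    simp [logChain]
  have h := norm_sum_sub_integral_add_le (G := logChain z)
    (fun k x hx => hasDerivAt_logChain hz k hx) 6 (C := 15300 * ‖z‖ ^ 7) hz
    (fun x hx => by
      rw [logChain, norm_neg, norm_mul]
      calc _ ≤ ‖z‖ * (15300 * ‖z‖ ^ 6 * Real.exp (-(z.re * x))) := by
            gcongr; exact norm_fermiChain_six_le hz hz' hx
        _ = _ := by ring)
    (tendsto_logChain hz) (a := 1) (by simp) (tendsto_integral_logChain hz) hS
  obtain ⟨p0, p1, p2, p3, p4, p5⟩ := fermiPoly_values
  have g0 : logOneAddExp (((0 : ℝ) : ℂ) * z) = (Real.log 2 : ℝ) := by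
    simp [logOneAddExp, one_add_one_eq_two]
  have o3 : bernoulli 3 = 0 := bernoulli_eq_zero_of_odd (by decide) (by norm_num)
  have o5 : bernoulli 5 = 0 := bernoulli_eq_zero_of_odd (by decide) (by norm_num)
  have o7 : bernoulli 7 = 0 := bernoulli_eq_zero_of_odd (by decide) (by norm_num)
  have b1 : bernNorm 1 1 = 1 / 2 := by simp [bernNorm, bernoulliFun_one]; norm_num
  have b2 : bernNorm 2 1 = 1 / 12 := by simp [bernNorm, bernoulliFun_two]; norm_num
  have b3 : bernNorm 3 1 = 0 := by rw [bernNorm_eval_one (by norm_num), o3]; simp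
  have b5 : bernNorm 5 1 = 0 := by rw [bernNorm_eval_one (by norm_num), o5]; simp
  have b7 : bernNorm 7 1 = 0 := by rw [bernNorm_eval_one (by norm_num), o7]; simp
  simp only [Finset.sum_range_succ, Finset.range_zero, Finset.sum_empty, zero_add, Nat.reduceAdd,
    g0, logChain, fermiChain_zero_right, p0, p2, p4, b1, b2, b3, b5, b7] at h
  refine le_trans (le_of_eq ?_) (h.trans (le_of_eq ?_))
  · congr 1
    push_cast
    ring
  · ring

end

end DistinctParts

namespace DistinctParts

noncomputable section

open Filter Topology MeasureTheory Set

/-! ### The infinite product away from the positive real axis -/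

/-- Among the numbers of given modulus `ρ < 1`, the quantity `-log |1 - x|` is largest at `x = ρ`,
and the gap is at least the one visible in the linear terms: all coefficients of `-log (1 - x)` are
nonnegative. -/
lemma neg_log_norm_one_sub_le {x : ℂ} (hx : ‖x‖ < 1) :
    -Real.log ‖1 - x‖ ≤ -Real.log (1 - ‖x‖) + (x.re - ‖x‖) := by
  have h1 := Complex.hasSum_re (Complex.hasSum_taylorSeries_neg_log hx)
  have h2 := Complex.hasSum_re (Complex.hasSum_taylorSeries_neg_log (z := (‖x‖ : ℂ)) (by simpa))
  have h3 := h2.sub h1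
  have h4 := le_hasSum h3 1 (fun n _ => by
    have e1 : ((‖x‖ : ℂ) ^ n / n).re = ‖x‖ ^ n / n := by
      rw [← Complex.ofReal_pow, ← Complex.ofReal_natCast, ← Complex.ofReal_div, Complex.ofReal_re]
    have e2 : (x ^ n / (n : ℂ)).re = (x ^ n).re / n := Complex.div_natCast_re _ _
    rw [e1, e2, ← sub_div]
    refine div_nonneg ?_ (Nat.cast_nonneg n)
    have := Complex.re_le_norm (x ^ n)
    rw [norm_pow] at this
    linarith)
  have e3 : (-Complex.log (1 - (‖x‖ : ℂ))).re = -Real.log (1 - ‖x‖) := by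
    rw [Complex.neg_re, Complex.log_re, ← Complex.ofReal_one, ← Complex.ofReal_sub,
      Complex.norm_real, Real.norm_of_nonneg (by linarith)]
  rw [e3, Complex.neg_re, Complex.log_re] at h4
  simp only [pow_one, Nat.cast_one, div_one, Complex.ofReal_re] at h4
  linarith

/-- The real part of `logDistinctGen` as a sum over odd parts, by Euler's identity
`∏ (1 + q ^ m) = ∏ 1 / (1 - q ^ (2 m - 1))`. -/
lemma hasSum_re_logDistinctGen {z : ℂ} (hz : 0 < z.re) :
    HasSum (fun m : ℕ => -Real.log ‖1 - Complex.exp (-(((2 * m + 1 : ℕ) : ℂ) * z))‖)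
      (logDistinctGen z).re := by
  set l : ℕ → ℝ := fun m => -Real.log ‖1 - Complex.exp (-(((m + 1 : ℕ) : ℂ) * z))‖ with hl
  have hlt : ∀ m : ℕ, ‖Complex.exp (-(((m + 1 : ℕ) : ℂ) * z))‖ < 1 := by
    intro m
    rw [Complex.norm_exp, Complex.neg_re, re_natCast_mul, Real.exp_lt_one_iff]
    have : (0 : ℝ) < ((m + 1 : ℕ) : ℝ) := by positivity
    nlinarith [mul_pos this hz]
  have hs : Summable l := by
    refine Summable.of_norm_bounded (summable_geometric_bound hz) fun m => ?_
    have hr : ‖-Complex.exp (-(((m + 1 : ℕ) : ℂ) * z))‖ < 1 := by rw [norm_neg]; exact hlt m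
    have h1 := norm_log_one_add_le_div hr
    rw [← sub_eq_add_neg, norm_neg, Complex.norm_exp, Complex.neg_re, re_natCast_mul] at h1
    have h2 := Complex.abs_re_le_norm (Complex.log (1 - Complex.exp (-(((m + 1 : ℕ) : ℂ) * z))))
    rw [Complex.log_re] at h2
    rw [hl]
    simp only [norm_neg, Real.norm_eq_abs]
    refine h2.trans (h1.trans ((exp_neg_pow_le_div hz (by omega)).trans ?_))
    have h0 := exp_neg_re_mem hz
    have h3 : 0 ≤ (1 - Real.exp (-z.re))⁻¹ := inv_nonneg.2 (by linarith [h0.2])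
    exact mul_le_mul_of_nonneg_left (pow_le_pow_of_le_one h0.1.le h0.2.le (by omega)) h3
  have hse : Summable fun m : ℕ => l (2 * m) :=
    hs.comp_injective fun a b h => by simpa using h
  have hso : Summable fun m : ℕ => l (2 * m + 1) :=
    hs.comp_injective fun a b h => by simpa using h
  have h1 : HasSum (fun m : ℕ => l m - l (2 * m + 1)) (logDistinctGen z).re := by
    refine (Complex.hasSum_re (hasSum_logDistinctGen hz)).congr_fun fun m => ?_
    have e : Complex.exp (-(((2 * m + 1 + 1 : ℕ) : ℂ) * z))
        = Complex.exp (-(((m + 1 : ℕ) : ℂ) * z)) ^ 2 := by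
      rw [← Complex.exp_nat_mul]; congr 1; push_cast; ring
    have hne : ∀ u : ℂ, ‖u‖ < 1 → ‖1 - u‖ ≠ 0 := by
      intro u hu h0
      rw [norm_eq_zero, sub_eq_zero] at h0
      rw [← h0] at hu; simp at hu
    set q := Complex.exp (-(((m + 1 : ℕ) : ℂ) * z)) with hq
    have h5 : ‖1 + q‖ ≠ 0 := by
      have := hne (-q) (by rw [norm_neg]; exact hlt m)
      rwa [sub_neg_eq_add] at this
    have h6 : ‖1 - q ^ 2‖ = ‖1 - q‖ * ‖1 + q‖ := by rw [← norm_mul]; congr 1; ring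
    simp only [hl]
    rw [e, ← hq, h6, Real.log_mul (hne q (hlt m)) h5, logOneAddExp, Complex.log_re]
    ring
  have h2 := h1.unique (hs.hasSum.sub hso.hasSum)
  have h3 := tsum_even_add_odd hse hso
  have h4 : (logDistinctGen z).re = ∑' m : ℕ, l (2 * m) := by rw [h2, ← h3]; ring
  rw [h4]
  exact hse.hasSum

lemma hasSum_exp_odd {z : ℂ} (hz : 0 < z.re) :
    HasSum (fun m : ℕ => Complex.exp (-(((2 * m + 1 : ℕ) : ℂ) * z))) (1 / (2 * Complex.sinh z)) := by
  have hlt : ‖Complex.exp (-(2 * z))‖ < 1 := by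
    rw [Complex.norm_exp, Complex.neg_re, Real.exp_lt_one_iff]
    simp; exact hz
  have h := (hasSum_geometric_of_norm_lt_one hlt).mul_left (Complex.exp (-z))
  have hne : 1 - Complex.exp (-(2 * z)) ≠ 0 := by
    intro h0
    rw [sub_eq_zero] at h0
    rw [← h0] at hlt; simp at hlt
  have e : 1 / (2 * Complex.sinh z) = Complex.exp (-z) * (1 - Complex.exp (-(2 * z)))⁻¹ := by
    have h1 : 2 * Complex.sinh z = Complex.exp z * (1 - Complex.exp (-(2 * z))) := by
      rw [Complex.two_sinh, mul_sub, ← Complex.exp_add]; ring_nf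
    rw [h1, Complex.exp_neg z]
    field_simp
  rw [e]
  refine h.congr_fun fun m => ?_
  rw [← Complex.exp_nat_mul, ← Complex.exp_add]
  congr 1; push_cast; ring

/-- Moving off the real axis decreases the generating function by at least the factor coming from
the linear terms `q ^ m`, `m` odd, of the logarithm. -/
lemma re_logDistinctGen_le {z : ℂ} (hz : 0 < z.re) :
    (logDistinctGen z).re ≤ (logDistinctGen z.re).re
      + ((1 / (2 * Complex.sinh z)).re - 1 / (2 * Real.sinh z.re)) := by
  have h1 := hasSum_re_logDistinctGen hz
  have h2 := hasSum_re_logDistinctGen (z := (z.re : ℂ)) (by simpa)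
  have h3 := Complex.hasSum_re (hasSum_exp_odd hz)
  have h4 := Complex.hasSum_re (hasSum_exp_odd (z := (z.re : ℂ)) (by simpa))
  have e4 : (1 / (2 * Complex.sinh (z.re : ℂ))).re = 1 / (2 * Real.sinh z.re) := by
    rw [← Complex.ofReal_sinh]; norm_cast
  rw [e4] at h4
  refine hasSum_le (fun m => ?_) h1 (h2.add (h3.sub h4))
  have hn : ‖Complex.exp (-(((2 * m + 1 : ℕ) : ℂ) * z))‖
      = Real.exp (-(((2 * m + 1 : ℕ) : ℝ) * z.re)) := by
    rw [Complex.norm_exp, Complex.neg_re, re_natCast_mul]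
  have hlt : Real.exp (-(((2 * m + 1 : ℕ) : ℝ) * z.re)) < 1 := by
    rw [Real.exp_lt_one_iff]
    have : (0 : ℝ) < ((2 * m + 1 : ℕ) : ℝ) := by positivity
    nlinarith [mul_pos this hz]
  have hr : Complex.exp (-(((2 * m + 1 : ℕ) : ℂ) * (z.re : ℂ)))
      = ((Real.exp (-(((2 * m + 1 : ℕ) : ℝ) * z.re)) : ℝ) : ℂ) := by
    push_cast; rfl
  have h5 := neg_log_norm_one_sub_le (x := Complex.exp (-(((2 * m + 1 : ℕ) : ℂ) * z)))
    (by rw [hn]; exact hlt)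
  rw [hn] at h5
  rw [hr, ← Complex.ofReal_one, ← Complex.ofReal_sub, Complex.norm_real,
    Real.norm_of_nonneg (by linarith), Complex.ofReal_re]
  simpa using h5

lemma re_inv_two_sinh (x y : ℝ) :
    (1 / (2 * Complex.sinh ((x : ℂ) + y * Complex.I))).re
      = Real.sinh x * Real.cos y / (2 * (Real.sinh x ^ 2 + Real.sin y ^ 2)) := by
  have e : Complex.sinh ((x : ℂ) + y * Complex.I)
      = (Real.sinh x * Real.cos y : ℝ) + (Real.cosh x * Real.sin y : ℝ) * Complex.I := by
    rw [Complex.sinh_add, Complex.sinh_mul_I, Complex.cosh_mul_I]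
    push_cast; ring
  have hre : (2 * Complex.sinh ((x : ℂ) + y * Complex.I)).re = 2 * (Real.sinh x * Real.cos y) := by
    rw [e]
    generalize Real.sinh x * Real.cos y = a
    generalize Real.cosh x * Real.sin y = b
    simp
  have him : (2 * Complex.sinh ((x : ℂ) + y * Complex.I)).im = 2 * (Real.cosh x * Real.sin y) := by
    rw [e]
    generalize Real.sinh x * Real.cos y = a
    generalize Real.cosh x * Real.sin y = b
    simp
  rw [one_div, Complex.inv_re, Complex.normSq_apply, hre, him]
  have : 2 * (Real.sinh x * Real.cos y) * (2 * (Real.sinh x * Real.cos y))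
      + 2 * (Real.cosh x * Real.sin y) * (2 * (Real.cosh x * Real.sin y))
      = 2 * (2 * (Real.sinh x ^ 2 + Real.sin y ^ 2)) := by
    have h1 := Real.cosh_sq x
    have h2 := Real.sin_sq_add_cos_sq y
    linear_combination 4 * Real.sin y ^ 2 * h1 + 4 * Real.sinh x ^ 2 * h2
  rw [this, mul_div_mul_left _ _ two_ne_zero]

lemma sinh_le_of_le {x : ℝ} (hx : 0 < x) (hx1 : x ≤ 1 / 25) : Real.sinh x ≤ 26 / 25 * x := by
  have h1 := (abs_le.1 (Real.abs_exp_sub_one_sub_id_le (x := x) (by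
    rw [abs_of_pos hx]; linarith))).2
  have h2 := (abs_le.1 (Real.abs_exp_sub_one_sub_id_le (x := -x) (by
    rw [abs_neg, abs_of_pos hx]; linarith))).1
  rw [Real.sinh_eq]
  nlinarith

/-- The loss in the linear terms once `|Im z| ≥ Re z / 2`. Any constant above `π ^ 2 / 12 - 3 / 4` on
the right serves the bound `3 / (4 η)` for the generating function. -/
lemma inv_two_sinh_gap {η y : ℝ} (hη : 0 < η) (hη1 : η ≤ 1 / 25) (hy : η / 2 ≤ |y|)
    (hy' : |y| ≤ Real.pi) :
    (1 / (2 * Complex.sinh ((η : ℂ) + y * Complex.I))).re - 1 / (2 * Real.sinh η)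
      ≤ -(2 / 25 / η) := by
  rw [re_inv_two_sinh]
  set S := Real.sinh η with hS
  have hS0 : 0 < S := Real.sinh_pos_iff.2 hη
  have hS1 : S ≤ 26 / 25 * η := sinh_le_of_le hη hη1
  by_cases hc : |y| ≤ Real.pi / 2
  · have hs : 49 / 100 * η ≤ Real.sin |y| := by
      have h1 : Real.sin (η / 2) ≤ Real.sin |y| :=
        Real.sin_le_sin_of_le_of_le_pi_div_two (by linarith [Real.pi_pos]) hc hy
      have h2 := Real.sin_gt_sub_cube (x := η / 2) (by linarith)
      nlinarith [mul_pos hη hη, mul_pos (mul_pos hη hη) hη]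
    have hs2 : Real.sin y ^ 2 = Real.sin |y| ^ 2 := by
      rcases abs_choice y with h | h <;> rw [h]
      rw [Real.sin_neg, neg_sq]
    rw [hs2]
    set s := Real.sin |y|
    have hs0 : 0 < s := lt_of_lt_of_le (by positivity) hs
    have h3 : S * Real.cos y / (2 * (S ^ 2 + s ^ 2)) ≤ S / (2 * (S ^ 2 + s ^ 2)) := by
      have : S * Real.cos y ≤ S := by nlinarith [Real.cos_le_one y]
      gcongr
    have h4 : S / (2 * (S ^ 2 + s ^ 2)) - 1 / (2 * S) = -(s ^ 2 / (2 * S * (S ^ 2 + s ^ 2))) := by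
      field_simp; ring
    have h5 : 2 / 25 / η ≤ s ^ 2 / (2 * S * (S ^ 2 + s ^ 2)) := by
      rw [div_le_div_iff₀ hη (by positivity)]
      have a1 : S ^ 2 ≤ (26 / 25 * η) ^ 2 := by gcongr
      have a2 : (49 / 100 * η) ^ 2 ≤ s ^ 2 := by gcongr
      have a3 : S * (S ^ 2 + s ^ 2) ≤ 26 / 25 * η * ((26 / 25 * η) ^ 2 + s ^ 2) := by gcongr
      nlinarith [mul_le_mul_of_nonneg_left a2 hη.le]
    linarith
  · have hcos : Real.cos y ≤ 0 := by
      rw [← Real.cos_abs]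
      push Not at hc
      exact Real.cos_nonpos_of_pi_div_two_le_of_le hc.le (by linarith [Real.pi_pos])
    have h3 : S * Real.cos y / (2 * (S ^ 2 + Real.sin y ^ 2)) ≤ 0 :=
      div_nonpos_of_nonpos_of_nonneg (mul_nonpos_of_nonneg_of_nonpos hS0.le hcos) (by positivity)
    have h4 : 2 / 25 / η ≤ 1 / (2 * S) := by
      rw [div_le_div_iff₀ hη (by positivity)]
      linarith
    linarith

lemma re_logDistinctGen_real_le {η : ℝ} (hη : 0 < η) (hη1 : η ≤ 1 / 25) :
    (logDistinctGen η).re ≤ Real.pi ^ 2 / (12 * η) := by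
  have h := norm_logDistinctGen_sub_le (z := (η : ℂ)) (by simpa) (by simp; positivity)
  have h1 := (Complex.re_le_norm _).trans h
  have e : ((Real.pi : ℂ) ^ 2 / (12 * (η : ℂ)) - 1 / 2 * (Real.log 2 : ℝ) + (η : ℂ) / 24)
      = ((Real.pi ^ 2 / (12 * η) - 1 / 2 * Real.log 2 + η / 24 : ℝ) : ℂ) := by push_cast; ring
  rw [e, Complex.sub_re, Complex.ofReal_re, Complex.ofReal_re, Complex.norm_real,
    Real.norm_of_nonneg hη.le] at h1
  have h2 : 30600 * η ^ 7 / η = 30600 * η ^ 6 := by field_simp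
  have h3 : η ^ 6 ≤ (1 / 25) ^ 6 := by gcongr
  have := Real.log_two_gt_d9
  rw [h2] at h1
  norm_num at h3
  linarith

/-- The generating function of partitions into distinct parts away from the positive real axis. -/
lemma re_logDistinctGen_le_of_outer {η y : ℝ} (hη : 0 < η) (hη1 : η ≤ 1 / 25) (hy : η / 2 ≤ |y|)
    (hy' : |y| ≤ Real.pi) :
    (logDistinctGen ((η : ℂ) + y * Complex.I)).re ≤ 3 / 4 / η := by
  have h1 := re_logDistinctGen_le (z := (η : ℂ) + y * Complex.I) (by rwa [re_arc])
  rw [re_arc] at h1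
  have h2 := inv_two_sinh_gap hη hη1 hy hy'
  have h3 := re_logDistinctGen_real_le hη hη1
  have h4 : Real.pi ^ 2 / (12 * η) - 2 / 25 / η ≤ 3 / 4 / η := by
    have : Real.pi ^ 2 ≤ 9.88 := by
      have := Real.pi_lt_d4
      nlinarith [Real.pi_pos]
    have e : Real.pi ^ 2 / (12 * η) - 2 / 25 / η = (Real.pi ^ 2 / 12 - 2 / 25) / η := by
      field_simp
    rw [e]
    gcongr
    linarith
  linarith

end

end DistinctParts

namespace DistinctParts

noncomputable section

open Filter Topology MeasureTheory Set

/-! ### The integrand on the inner and outer arcs -/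

/-- The truncated expansion of the Lambert series at `z = 0`. -/
def lambertMain (r t : ℕ) (z : ℂ) : ℂ :=
  (Real.log 2 : ℝ) / (t * z) - 1 / 2 * (bern 1 (r / t) : ℝ)
    + (t * z) / 8 * (bern 2 (r / t) : ℝ) - (t * z) ^ 3 / 192 * (bern 4 (r / t) : ℝ)

/-- The leading factor `e ^ (n z + z / 24 + π ^ 2 / (12 z)) / √2` of the integrand on the major
arc. -/
def arcFactor (n : ℕ) (z : ℂ) : ℂ :=
  Complex.exp ((Real.pi : ℂ) ^ 2 / (12 * z) + ((n : ℂ) + 1 / 24) * z) / ((√2 : ℝ) : ℂ)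

/-- The integrand of Cauchy's formula for `D r t n`. -/
def cauchyIntegrand (r t n : ℕ) (z : ℂ) : ℂ :=
  Complex.exp (logDistinctGen z) * lambertSum r t z * Complex.exp (n * z)

lemma re_arcPoint (n : ℕ) (y : ℝ) : (arcPoint n y).re = eta n := re_arc _ _

lemma im_arcPoint (n : ℕ) (y : ℝ) : (arcPoint n y).im = y := im_arc _ _

lemma continuous_arcPoint (n : ℕ) : Continuous (arcPoint n) := continuous_arc _

section size

variable {t n : ℕ}

lemma eta_pos (hn : 0 < n) : 0 < eta n := by
  have : (0 : ℝ) < n := by exact_mod_cast hn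
  unfold eta
  positivity

lemma eta_sq (n : ℕ) : eta n ^ 2 = Real.pi ^ 2 / (12 * n) := by
  unfold eta
  rw [div_pow, Real.sq_sqrt (by positivity)]

lemma mul_eta_le (hn : 400 * (t : ℝ) ^ 2 / 3 < n) : t * eta n ≤ 2 / 25 := by
  have hn0 : (0 : ℝ) < n := lt_of_le_of_lt (by positivity) hn
  have h : (t * eta n) ^ 2 ≤ (2 / 25) ^ 2 := by
    rw [mul_pow, eta_sq, mul_div_assoc', div_le_iff₀ (by positivity)]
    have hp : Real.pi ^ 2 ≤ 10 := by nlinarith [Real.pi_pos, Real.pi_lt_d2]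
    nlinarith [sq_nonneg (t : ℝ)]
  exact le_of_sq_le_sq h (by norm_num)

lemma eta_le (ht : 2 ≤ t) (hn : 400 * (t : ℝ) ^ 2 / 3 < n) : eta n ≤ 1 / 25 := by
  have h := mul_eta_le hn
  have ht' : (2 : ℝ) ≤ t := by exact_mod_cast ht
  have : 0 ≤ eta n := by unfold eta; positivity
  nlinarith

lemma pi_sq_div_eta (hn : 0 < n) : Real.pi ^ 2 / (12 * eta n) = n * eta n := by
  have h := eta_sq n
  have hp := eta_pos hn
  have : (0 : ℝ) < n := by exact_mod_cast hn
  rw [eq_div_iff (by positivity)] at h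
  rw [div_eq_iff (by positivity)]
  linarith

/-- The maximum over the arc of the exponent of `arcFactor`, up to the term `η / 24`. -/
lemma main_exponent (n : ℕ) : Real.pi * √((n : ℝ) / 3) = 2 * (n * eta n) := by
  unfold eta
  have h1 : √(12 * (n : ℝ)) = 2 * √3 * √n := by
    rw [Real.sqrt_mul (by norm_num), show (12 : ℝ) = 2 ^ 2 * 3 by norm_num,
      Real.sqrt_mul (by norm_num), Real.sqrt_sq (by norm_num)]
  rw [h1, Real.sqrt_div (Nat.cast_nonneg n)]
  rcases Nat.eq_zero_or_pos n with rfl | hn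
  · simp
  · have h0 : (0 : ℝ) < n := by exact_mod_cast hn
    have h2 : √(n : ℝ) ^ 2 = n := Real.sq_sqrt h0.le
    have : 0 < √(n : ℝ) := Real.sqrt_pos.2 h0
    field_simp
    exact h2

lemma outer_exponent (hn : 0 < n) :
    (3 * √3 / (2 * Real.pi) + Real.pi / √12) * √(n : ℝ) = 3 / 4 / eta n + n * eta n := by
  unfold eta
  have h0 : (0 : ℝ) < n := by exact_mod_cast hn
  have h12 : √12 = 2 * √3 := by
    rw [show (12 : ℝ) = 2 ^ 2 * 3 by norm_num,
      Real.sqrt_mul (by norm_num), Real.sqrt_sq (by norm_num)]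
  have h1 : √(12 * (n : ℝ)) = 2 * √3 * √n := by
    rw [Real.sqrt_mul (by norm_num), h12]
  rw [h1, h12]
  have h2 : √(n : ℝ) ^ 2 = n := Real.sq_sqrt h0.le
  have h3 : √(3 : ℝ) ^ 2 = 3 := Real.sq_sqrt (by norm_num)
  have h4 : 0 < √(n : ℝ) := Real.sqrt_pos.2 h0
  have h5 := Real.pi_pos
  rw [show (n : ℝ) * (Real.pi / (2 * √3 * √n)) = √(n : ℝ) ^ 2 * (Real.pi / (2 * √3 * √n)) by
    rw [h2]]
  field_simp
  ring

end size

section arc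

variable {r t n : ℕ}

lemma V_eq (s n : ℕ) : V s n = 1 / (2 * (Real.pi : ℂ)) *
    ∫ y in (-(10 * eta n))..(10 * eta n),
      arcPoint n y ^ ((s : ℤ) - 1) * arcFactor n (arcPoint n y) := by
  unfold V arcFactor
  have h2 : ((√2 : ℝ) : ℂ) ≠ 0 := by
    have : (√2 : ℝ) ≠ 0 := by positivity
    exact_mod_cast this
  rw [← intervalIntegral.integral_const_mul, ← intervalIntegral.integral_const_mul]
  refine intervalIntegral.integral_congr fun y _ => ?_
  have := Complex.I_ne_zero
  have : (Real.pi : ℂ) ≠ 0 := by exact_mod_cast Real.pi_ne_zero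
  field_simp

lemma arcPoint_ne_zero (hn : 0 < n) (y : ℝ) : arcPoint n y ≠ 0 := by
  intro h
  have := congrArg Complex.re h
  rw [re_arcPoint, Complex.zero_re] at this
  exact (eta_pos hn).ne' this

lemma continuous_arcFactor (hn : 0 < n) : Continuous fun y => arcFactor n (arcPoint n y) := by
  unfold arcFactor
  have h := continuous_arcPoint n
  have h2 : Continuous fun y => (Real.pi : ℂ) ^ 2 / (12 * arcPoint n y) :=
    continuous_const.div (by fun_prop) fun y => mul_ne_zero (by norm_num) (arcPoint_ne_zero hn y)
  fun_prop

lemma continuous_lambertMain (ht : 1 ≤ t) (hn : 0 < n) :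
    Continuous fun y => lambertMain r t (arcPoint n y) := by
  unfold lambertMain
  have h := continuous_arcPoint n
  have ht' : (t : ℂ) ≠ 0 := by exact_mod_cast (by omega : t ≠ 0)
  have h2 : Continuous fun y => ((Real.log 2 : ℝ) : ℂ) / (t * arcPoint n y) :=
    continuous_const.div (by fun_prop) fun y => mul_ne_zero ht' (arcPoint_ne_zero hn y)
  fun_prop

lemma continuous_cauchyIntegrand (hr : 1 ≤ r) (hrt : r ≤ t) (hn : 0 < n) :
    Continuous fun y => cauchyIntegrand r t n (arcPoint n y) := by
  unfold cauchyIntegrand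
  have h := continuous_arcPoint n
  have h1 : Continuous fun y => logDistinctGen (arcPoint n y) :=
    continuous_logDistinctGen_arc (eta_pos hn)
  have h2 : Continuous fun y => lambertSum r t (arcPoint n y) :=
    continuous_lambertSum_arc (eta_pos hn) hr (hr.trans hrt)
  fun_prop

/-- The main terms form a single integral over the major arc. -/
lemma sum_V_eq (ht : 1 ≤ t) (hn : 0 < n) :
    ((Real.log 2 / (t : ℝ) : ℝ) : ℂ) * V 0 n
        - ((1 / 2 * bern 1 ((r : ℝ) / (t : ℝ)) : ℝ) : ℂ) * V 1 n
        + (((t : ℝ) / 8 * bern 2 ((r : ℝ) / (t : ℝ)) : ℝ) : ℂ) * V 2 n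
        - (((t : ℝ) ^ 3 / 192 * bern 4 ((r : ℝ) / (t : ℝ)) : ℝ) : ℂ) * V 4 n
      = 1 / (2 * (Real.pi : ℂ)) * ∫ y in (-(10 * eta n))..(10 * eta n),
        arcFactor n (arcPoint n y) * lambertMain r t (arcPoint n y) := by
  have hA := continuous_arcFactor hn
  have hi : ∀ s : ℕ, IntervalIntegrable (fun y => arcPoint n y ^ ((s : ℤ) - 1)
      * arcFactor n (arcPoint n y)) volume (-(10 * eta n)) (10 * eta n) := fun s =>
    (((continuous_arcPoint n).zpow₀ _ fun y => Or.inl (arcPoint_ne_zero hn y)).mul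
      hA).intervalIntegrable _ _
  simp only [V_eq]
  have hsplit : ∀ c0 c1 c2 c4 J0 J1 J2 J4 p : ℂ, c0 * (p * J0) - c1 * (p * J1) + c2 * (p * J2)
      - c4 * (p * J4) = p * (c0 * J0 - c1 * J1 + c2 * J2 - c4 * J4) := by intros; ring
  rw [hsplit]
  congr 1
  simp only [← intervalIntegral.integral_const_mul]
  rw [← intervalIntegral.integral_sub ((hi 0).const_mul _) ((hi 1).const_mul _),
    ← intervalIntegral.integral_add (((hi 0).const_mul _).sub ((hi 1).const_mul _))
      ((hi 2).const_mul _),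
    ← intervalIntegral.integral_sub ((((hi 0).const_mul _).sub ((hi 1).const_mul _)).add
      ((hi 2).const_mul _)) ((hi 4).const_mul _)]
  refine intervalIntegral.integral_congr fun y _ => ?_
  have hz := arcPoint_ne_zero hn y
  have ht' : (t : ℂ) ≠ 0 := by exact_mod_cast (by omega : t ≠ 0)
  simp only [lambertMain]
  have e0 : arcPoint n y ^ (((0 : ℕ) : ℤ) - 1) = (arcPoint n y)⁻¹ := by
    rw [Nat.cast_zero, zero_sub, zpow_neg_one]
  have e1 : arcPoint n y ^ (((1 : ℕ) : ℤ) - 1) = 1 := by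
    rw [Nat.cast_one, sub_self, zpow_zero]
  have e2 : arcPoint n y ^ (((2 : ℕ) : ℤ) - 1) = arcPoint n y := by
    rw [show (((2 : ℕ) : ℤ) - 1) = 1 by norm_num, zpow_one]
  have e4 : arcPoint n y ^ (((4 : ℕ) : ℤ) - 1) = arcPoint n y ^ 3 := by
    rw [show (((4 : ℕ) : ℤ) - 1) = ((3 : ℕ) : ℤ) by norm_num, zpow_natCast]
  rw [e0, e1, e2, e4]
  push_cast
  field_simp

lemma norm_arcFactor (n : ℕ) (y : ℝ) : ‖arcFactor n (arcPoint n y)‖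
    = Real.exp (Real.pi ^ 2 / 12 * (eta n / (eta n ^ 2 + y ^ 2)) + (n + 1 / 24) * eta n) / √2 := by
  unfold arcFactor
  rw [norm_div, Complex.norm_exp, Complex.norm_real, Real.norm_of_nonneg (Real.sqrt_nonneg _)]
  congr 2
  have e1 : (Real.pi : ℂ) ^ 2 / (12 * arcPoint n y)
      = ((Real.pi ^ 2 / 12 : ℝ) : ℂ) * (arcPoint n y)⁻¹ := by
    push_cast; rw [div_mul_eq_div_div, div_eq_mul_inv]
  have e2 : ((n : ℂ) + 1 / 24) * arcPoint n y = (((n : ℝ) + 1 / 24 : ℝ) : ℂ) * arcPoint n y := by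
    push_cast; rfl
  rw [Complex.add_re, e1, e2, Complex.re_ofReal_mul, Complex.re_ofReal_mul, Complex.inv_re,
    Complex.normSq_apply, re_arcPoint, im_arcPoint]
  ring_nf

lemma exp_div_sqrt_two_le {x : ℝ} (hx : x ≤ 1 / 25) : Real.exp (x / 24) / √2 ≤ 1 := by
  rw [div_le_one (by positivity)]
  have h1 : Real.exp (x / 24) ≤ Real.exp (1 / 3) := Real.exp_le_exp.2 (by linarith)
  have h2 : Real.exp (1 / 3) ≤ √2 := by
    apply Real.le_sqrt_of_sq_le
    have h3 : (Real.exp (1 / 3) ^ 2) ^ 3 ≤ 2 ^ 3 := by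
      rw [← pow_mul, ← Real.exp_nat_mul, show ((2 * 3 : ℕ) : ℝ) * (1 / 3) = (2 : ℕ) * 1 by norm_num,
        Real.exp_nat_mul]
      have := Real.exp_one_lt_d9
      nlinarith [Real.exp_pos 1]
    exact le_of_pow_le_pow_left₀ (by norm_num) (by norm_num) h3
  linarith

lemma norm_arcFactor_le (hn : 0 < n) (h1 : eta n ≤ 1 / 25) (y : ℝ) :
    ‖arcFactor n (arcPoint n y)‖ ≤ Real.exp (2 * (n * eta n)) := by
  have hη := eta_pos hn
  rw [norm_arcFactor]
  have e : Real.pi ^ 2 / 12 * (eta n / (eta n ^ 2 + y ^ 2)) ≤ n * eta n := by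
    rw [← pi_sq_div_eta hn]
    have : eta n / (eta n ^ 2 + y ^ 2) ≤ 1 / eta n := by
      rw [div_le_div_iff₀ (by positivity) hη]
      nlinarith [sq_nonneg y]
    calc _ ≤ Real.pi ^ 2 / 12 * (1 / eta n) := by gcongr
      _ = _ := by field_simp
  have h2 : Real.exp (Real.pi ^ 2 / 12 * (eta n / (eta n ^ 2 + y ^ 2)) + (n + 1 / 24) * eta n)
      ≤ Real.exp (2 * (n * eta n)) * Real.exp (eta n / 24) := by
    rw [← Real.exp_add]
    apply Real.exp_le_exp.2
    linarith
  calc _ ≤ Real.exp (2 * (n * eta n)) * Real.exp (eta n / 24) / √2 := by gcongr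
    _ = Real.exp (2 * (n * eta n)) * (Real.exp (eta n / 24) / √2) := by ring
    _ ≤ Real.exp (2 * (n * eta n)) * 1 := by gcongr; exact exp_div_sqrt_two_le h1
    _ = _ := mul_one _

/-- For `|y| ≥ η / 2` the exponent `π ^ 2 η / (12 (η ^ 2 + y ^ 2))` falls below `3 / (4 η)`. -/
lemma norm_arcFactor_le_of_outer (hn : 0 < n) (h1 : eta n ≤ 1 / 25) {y : ℝ}
    (hy : eta n / 2 ≤ |y|) :
    ‖arcFactor n (arcPoint n y)‖ ≤ Real.exp (3 / 4 / eta n + n * eta n) := by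
  have hη := eta_pos hn
  rw [norm_arcFactor]
  have e : Real.pi ^ 2 / 12 * (eta n / (eta n ^ 2 + y ^ 2)) ≤ 3 / 4 / eta n := by
    have hy2 : (eta n / 2) ^ 2 ≤ y ^ 2 := by
      rw [← sq_abs y]; gcongr
    have : eta n / (eta n ^ 2 + y ^ 2) ≤ 4 / 5 / eta n := by
      rw [div_le_div_iff₀ (by positivity) hη]
      nlinarith
    have hp : Real.pi ^ 2 ≤ 10 := by nlinarith [Real.pi_pos, Real.pi_lt_d2]
    calc _ ≤ 10 / 12 * (4 / 5 / eta n) := by gcongr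
      _ ≤ 3 / 4 / eta n := by
        rw [← mul_div_assoc]
        gcongr
        norm_num
  have h2 : Real.exp (Real.pi ^ 2 / 12 * (eta n / (eta n ^ 2 + y ^ 2)) + (n + 1 / 24) * eta n)
      ≤ Real.exp (3 / 4 / eta n + n * eta n) * Real.exp (eta n / 24) := by
    rw [← Real.exp_add]
    apply Real.exp_le_exp.2
    linarith
  calc _ ≤ Real.exp (3 / 4 / eta n + n * eta n) * Real.exp (eta n / 24) / √2 := by gcongr
    _ = Real.exp (3 / 4 / eta n + n * eta n) * (Real.exp (eta n / 24) / √2) := by ring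
    _ ≤ Real.exp (3 / 4 / eta n + n * eta n) * 1 := by gcongr; exact exp_div_sqrt_two_le h1
    _ = _ := mul_one _

/-- Here `28 / 25` stands for `√5 / 2`. -/
lemma norm_arcPoint_le_of_inner (hn : 0 < n) {y : ℝ} (hy : |y| ≤ eta n / 2) :
    ‖arcPoint n y‖ ≤ 28 / 25 * eta n := by
  have hη := eta_pos hn
  have h : ‖arcPoint n y‖ ^ 2 = eta n ^ 2 + y ^ 2 := by
    rw [Complex.sq_norm, Complex.normSq_apply, re_arcPoint, im_arcPoint]; ring
  have hy2 : y ^ 2 ≤ (eta n / 2) ^ 2 := by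
    rw [← sq_abs y]; gcongr
  refine le_of_sq_le_sq ?_ (by positivity)
  rw [h]
  nlinarith

lemma exp_logDistinctGen_mul_exp (y : ℝ) {E : ℂ}
    (hE : logDistinctGen (arcPoint n y) = (Real.pi : ℂ) ^ 2 / (12 * arcPoint n y)
      - 1 / 2 * (Real.log 2 : ℝ) + arcPoint n y / 24 + E) :
    Complex.exp (logDistinctGen (arcPoint n y)) * Complex.exp (n * arcPoint n y)
      = arcFactor n (arcPoint n y) * Complex.exp E := by
  have h2 : Complex.exp (1 / 2 * (Real.log 2 : ℝ)) = ((√2 : ℝ) : ℂ) := by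
    rw [Real.sqrt_eq_rpow, Real.rpow_def_of_pos two_pos]
    push_cast
    congr 1
    ring
  rw [arcFactor, ← h2, ← Complex.exp_sub, ← Complex.exp_add, ← Complex.exp_add, hE]
  congr 1
  ring

/-- On the inner arc the integrand is close to its main term: the relative error of the generating
function is `O(η ^ 6)`, while the expansion of the Lambert series misses `O((t η) ^ 5)`. -/
lemma norm_cauchyIntegrand_sub_le (ht : 2 ≤ t) (hr : 1 ≤ r) (hrt : r ≤ t)
    (hn : 400 * (t : ℝ) ^ 2 / 3 < n) (hn0 : 0 < n) {y : ℝ} (hy : |y| ≤ eta n / 2) :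
    ‖cauchyIntegrand r t n (arcPoint n y) - arcFactor n (arcPoint n y)
        * lambertMain r t (arcPoint n y)‖
      ≤ 63000 * (t * eta n) ^ 5 * Real.exp (2 * (n * eta n)) := by
  have hη := eta_pos hn0
  have hη1 := eta_le ht hn
  have htη := mul_eta_le hn
  have ht' : (2 : ℝ) ≤ t := by exact_mod_cast ht
  have ht0 : (0 : ℝ) < t := by linarith
  have hA := norm_arcFactor_le hn0 hη1 y
  have hzn := norm_arcPoint_le_of_inner hn0 hy
  have hzre := re_arcPoint n y
  set z := arcPoint n y with hz
  set η := eta n with hηd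
  have hre : 0 < z.re := by rwa [hzre]
  have him : |z.im| ≤ z.re / 2 := by rw [hzre, hz, im_arcPoint]; exact hy
  set E := logDistinctGen z - ((Real.pi : ℂ) ^ 2 / (12 * z) - 1 / 2 * (Real.log 2 : ℝ) + z / 24)
    with hEd
  have hE : ‖E‖ ≤ 67700 * η ^ 6 := by
    refine (norm_logDistinctGen_sub_le hre him).trans ?_
    rw [hzre, div_le_iff₀ hη]
    calc 30600 * ‖z‖ ^ 7 ≤ 30600 * (28 / 25 * η) ^ 7 := by gcongr
      _ = 30600 * (28 / 25) ^ 7 * η ^ 7 := by ring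
      _ ≤ 67700 * η ^ 7 := by gcongr; norm_num
      _ = _ := by ring
  have hE1 : ‖E‖ ≤ 1 := by
    have h6 : η ^ 6 ≤ (1 / 25) ^ 6 := by gcongr
    norm_num at h6
    linarith
  have hexp : ‖Complex.exp E - 1‖ ≤ 2 * ‖E‖ := Complex.norm_exp_sub_one_le hE1
  have hL : ‖lambertSum r t z‖ ≤ 297 / 250 / (t * η) := by
    refine (norm_lambertSum_le_of_sector hre him (by omega)).trans ?_
    rw [hzre, ← mul_div_assoc]
    gcongr
    linarith
  have hLM : ‖lambertSum r t z - lambertMain r t z‖ ≤ 60400 * (t * η) ^ 5 := by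
    refine (norm_lambertSum_sub_le hre him hr hrt).trans ?_
    have hw : ‖(t : ℂ) * z‖ ≤ 28 / 25 * (t * η) := by
      rw [norm_mul, Complex.norm_natCast]
      nlinarith
    rw [hzre]
    have hx : 0 < t * η := by positivity
    have h1 : 30600 * ‖(t : ℂ) * z‖ ^ 6 / (t * η) ≤ 60399 * (t * η) ^ 5 := by
      rw [div_le_iff₀ hx]
      calc 30600 * ‖(t : ℂ) * z‖ ^ 6 ≤ 30600 * (28 / 25 * (t * η)) ^ 6 := by gcongr
        _ = 30600 * (28 / 25) ^ 6 * (t * η) ^ 6 := by ring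
        _ ≤ 60399 * (t * η) ^ 6 := by gcongr; norm_num
        _ = _ := by ring
    have h2 : 1 / 8 * ‖(t : ℂ) * z‖ ^ 5 ≤ 1 * (t * η) ^ 5 := by
      calc 1 / 8 * ‖(t : ℂ) * z‖ ^ 5 ≤ 1 / 8 * (28 / 25 * (t * η)) ^ 5 := by gcongr
        _ = 1 / 8 * (28 / 25) ^ 5 * (t * η) ^ 5 := by ring
        _ ≤ 1 * (t * η) ^ 5 := by gcongr; norm_num
    linarith
  have hmul : Complex.exp (logDistinctGen z) * Complex.exp (n * z)
      = arcFactor n z * Complex.exp E :=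
    exp_logDistinctGen_mul_exp y (by rw [hEd, hz]; ring)
  have e : cauchyIntegrand r t n z - arcFactor n z * lambertMain r t z
      = arcFactor n z * ((Complex.exp E - 1) * lambertSum r t z
        + (lambertSum r t z - lambertMain r t z)) := by
    rw [cauchyIntegrand]
    linear_combination lambertSum r t z * hmul
  rw [e, norm_mul, mul_comm (63000 * (t * η) ^ 5)]
  refine mul_le_mul hA ?_ (norm_nonneg _) (Real.exp_pos _).le
  have h3 : ‖(Complex.exp E - 1) * lambertSum r t z‖ ≤ 2600 * (t * η) ^ 5 := by
    rw [norm_mul]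
    calc ‖Complex.exp E - 1‖ * ‖lambertSum r t z‖
        ≤ (2 * (67700 * η ^ 6)) * (297 / 250 / (t * η)) := by
          gcongr; linarith
      _ = 160855.2 * η ^ 5 / t := by field_simp; ring
      _ ≤ 2600 * (t * η) ^ 5 := by
          rw [div_le_iff₀ ht0]
          -- `η ^ 5 / t` is at most `t ^ 5 η ^ 5 / 64` because `t ≥ 2`
          have h6 : (2 : ℝ) ^ 6 ≤ (t : ℝ) ^ 6 := by gcongr
          have h5 : 0 < η ^ 5 := by positivity
          have e5 : 2600 * (t * η) ^ 5 * t = 2600 * t ^ 6 * η ^ 5 := by ring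
          rw [e5]
          gcongr
          linarith
  refine (norm_add_le _ _).trans ?_
  linarith

lemma norm_cauchyIntegrand_le_of_outer (hr : 1 ≤ r) (hrt : r ≤ t) (hn : 0 < n)
    (h1 : eta n ≤ 1 / 25) {y : ℝ} (hy : eta n / 2 ≤ |y|) (hy' : |y| ≤ Real.pi) :
    ‖cauchyIntegrand r t n (arcPoint n y)‖
      ≤ 4 / 3 * n * Real.exp (3 / 4 / eta n + n * eta n) := by
  have hη := eta_pos hn
  have hre : 0 < (arcPoint n y).re := by rwa [re_arcPoint]
  have hL := norm_lambertSum_le hre hr (hr.trans hrt)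
  rw [re_arcPoint] at hL
  have hinv : (1 - Real.exp (-eta n))⁻¹ ≤ 26 / 25 / eta n := by
    refine (inv_one_sub_exp_neg_le hη).trans ?_
    gcongr
    linarith
  have hinv0 : 0 ≤ (1 - Real.exp (-eta n))⁻¹ := inv_nonneg.2 (by linarith [(exp_neg_re_mem hη).2])
  have hL2 : ‖lambertSum r t (arcPoint n y)‖ ≤ 4 / 3 * n := by
    refine hL.trans ((pow_le_pow_left₀ hinv0 hinv 2).trans ?_)
    have hp : (9.8 : ℝ) ≤ Real.pi ^ 2 := by
      nlinarith [Real.pi_gt_d2]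
    have hn' : (0 : ℝ) < n := by exact_mod_cast hn
    rw [div_pow, eta_sq, div_div_eq_mul_div, div_le_iff₀ (by positivity)]
    nlinarith
  have hP : (logDistinctGen (arcPoint n y)).re ≤ 3 / 4 / eta n :=
    re_logDistinctGen_le_of_outer hη h1 hy hy'
  rw [cauchyIntegrand, norm_mul, norm_mul, Complex.norm_exp, Complex.norm_exp, re_natCast_mul,
    re_arcPoint, Real.exp_add]
  calc _ ≤ Real.exp (3 / 4 / eta n) * (4 / 3 * n) * Real.exp (n * eta n) := by gcongr
    _ = _ := by ring

lemma abs_bern_le (k : ℕ) {x : ℝ} (hx : x ∈ Icc (0 : ℝ) 1) :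
    |bern (k + 1) x| ≤ ((k + 1).factorial : ℝ) / 2 := by
  have h := abs_bernNorm_le k hx
  have hf : (0 : ℝ) < ((k + 1).factorial : ℝ) := by positivity
  rw [bernNorm_eq_bern, abs_div, abs_of_pos hf, div_le_iff₀ hf] at h
  linarith

lemma norm_lambertMain_le (ht : 2 ≤ t) (hrt : r ≤ t) (hn : 400 * (t : ℝ) ^ 2 / 3 < n)
    (hn0 : 0 < n) {y : ℝ} (hy : |y| ≤ 10 * eta n) :
    ‖lambertMain r t (arcPoint n y)‖ ≤ 1 / 2 / eta n := by
  have hη := eta_pos hn0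
  have hη1 := eta_le ht hn
  have htη := mul_eta_le hn
  have ht' : (2 : ℝ) ≤ t := by exact_mod_cast ht
  have ht0 : (0 : ℝ) < t := by linarith
  have hx : (r / t : ℝ) ∈ Icc (0 : ℝ) 1 :=
    ⟨by positivity, by rw [div_le_one ht0]; exact_mod_cast hrt⟩
  have hz : ‖arcPoint n y‖ ≤ 11 * eta n := by
    have := Complex.norm_le_abs_re_add_abs_im (arcPoint n y)
    rw [re_arcPoint, im_arcPoint, abs_of_pos hη] at this
    linarith
  have hz' : eta n ≤ ‖arcPoint n y‖ := by
    have := Complex.re_le_norm (arcPoint n y)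
    rwa [re_arcPoint] at this
  have hw : ‖(t : ℂ) * arcPoint n y‖ ≤ 1 := by
    rw [norm_mul, Complex.norm_natCast]
    nlinarith
  have hw' : 2 * eta n ≤ ‖(t : ℂ) * arcPoint n y‖ := by
    rw [norm_mul, Complex.norm_natCast]
    nlinarith
  set w := (t : ℂ) * arcPoint n y
  have b1 := abs_bern_le 0 hx
  have b2 := abs_bern_le 1 hx
  have b4 := abs_bern_le 3 hx
  norm_num [Nat.factorial] at b1 b2 b4
  have hlog : ‖((Real.log 2 : ℝ) : ℂ) / w‖ ≤ 7 / 20 / eta n := by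
    have h2 := Real.log_two_lt_d9
    have h2' : 0 < Real.log 2 := Real.log_pos one_lt_two
    rw [norm_div, Complex.norm_real, Real.norm_of_nonneg h2'.le]
    calc Real.log 2 / ‖w‖ ≤ (7 / 10) / (2 * eta n) := by gcongr; linarith
      _ = _ := by field_simp; norm_num
  have m1 : ‖(1 / 2 : ℂ) * (bern 1 (r / t) : ℝ)‖ ≤ 1 / 4 := by
    rw [norm_mul, Complex.norm_real, Real.norm_eq_abs]
    norm_num
    linarith
  have m2 : ‖w / 8 * (bern 2 (r / t) : ℝ)‖ ≤ 1 / 8 := by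
    rw [norm_mul, norm_div, Complex.norm_real, Real.norm_eq_abs]
    norm_num
    nlinarith [norm_nonneg w, abs_nonneg (bern 2 (r / t))]
  have m4 : ‖w ^ 3 / 192 * (bern 4 (r / t) : ℝ)‖ ≤ 1 / 16 := by
    rw [norm_mul, norm_div, norm_pow, Complex.norm_real, Real.norm_eq_abs]
    have h3 : ‖w‖ ^ 3 ≤ 1 := pow_le_one₀ (norm_nonneg w) hw
    have h3' : 0 ≤ ‖w‖ ^ 3 := by positivity
    norm_num
    nlinarith [abs_nonneg (bern 4 (r / t))]
  have h25 : 25 ≤ 1 / eta n := by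
    rw [le_div_iff₀ hη]; linarith
  have e7 : 7 / 20 / eta n = 7 / 20 * (1 / eta n) := by ring
  have e2 : 1 / 2 / eta n = 1 / 2 * (1 / eta n) := by ring
  rw [e2]
  rw [e7] at hlog
  unfold lambertMain
  refine (norm_sub_le _ _).trans ?_
  refine (add_le_add ((norm_add_le _ _).trans (add_le_add (norm_sub_le _ _) le_rfl))
    le_rfl).trans ?_
  linarith

end arc

end

end DistinctParts

namespace DistinctParts

noncomputable section

open MeasureTheory Set

/-! ### Comparison of the two integrals -/

/-- Comparison of two integrals over the same centre: the difference is the integral of the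
difference over `[-h, h]` plus the four outer pieces. -/
lemma norm_integral_sub_integral_le {F G : ℝ → ℂ} (hF : Continuous F) (hG : Continuous G)
    {h a b K A B : ℝ} (hh : 0 ≤ h) (ha : h ≤ a) (hb : h ≤ b)
    (hK : ∀ y, |y| ≤ h → ‖F y - G y‖ ≤ K)
    (hA : ∀ y, h ≤ |y| → |y| ≤ a → ‖F y‖ ≤ A) (hB : ∀ y, h ≤ |y| → |y| ≤ b → ‖G y‖ ≤ B) :
    ‖(∫ y in (-a)..a, F y) - ∫ y in (-b)..b, G y‖
      ≤ K * (2 * h) + 2 * (A * (a - h)) + 2 * (B * (b - h)) := by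
  have iF : ∀ u v, IntervalIntegrable F volume u v := fun u v => hF.intervalIntegrable u v
  have iG : ∀ u v, IntervalIntegrable G volume u v := fun u v => hG.intervalIntegrable u v
  have piece : ∀ (f : ℝ → ℂ) (C u v : ℝ), u ≤ v → (∀ y, u ≤ y → y ≤ v → ‖f y‖ ≤ C) →
      ‖∫ y in u..v, f y‖ ≤ C * (v - u) := by
    intro f C u v huv hf
    have := intervalIntegral.norm_integral_le_of_norm_le_const (f := f) (a := u) (b := v) (C := C)
      (by
        intro y hy
        rw [uIoc_of_le huv] at hy
        exact hf y hy.1.le hy.2)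
    rwa [abs_of_nonneg (by linarith)] at this
  have neg : ∀ {c y : ℝ}, -c ≤ y → y ≤ -h → h ≤ |y| ∧ |y| ≤ c := by
    intro c y h1 h2
    rw [abs_of_nonpos (by linarith)]
    constructor <;> linarith
  have pos : ∀ {c y : ℝ}, h ≤ y → y ≤ c → h ≤ |y| ∧ |y| ≤ c := by
    intro c y h1 h2
    rw [abs_of_nonneg (by linarith)]
    exact ⟨h1, h2⟩
  have split : ∀ (f : ℝ → ℂ) (c : ℝ), (∀ u v, IntervalIntegrable f volume u v) →
      ∫ y in (-c)..c, f y
        = (∫ y in (-c)..(-h), f y) + (∫ y in (-h)..h, f y) + ∫ y in h..c, f y := by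
    intro f c hf
    rw [intervalIntegral.integral_add_adjacent_intervals (hf _ _) (hf _ _),
      intervalIntegral.integral_add_adjacent_intervals (hf _ _) (hf _ _)]
  have e : (∫ y in (-a)..a, F y) - ∫ y in (-b)..b, G y
      = (∫ y in (-h)..h, (F y - G y)) + ((∫ y in (-a)..(-h), F y) + ∫ y in h..a, F y)
        - ((∫ y in (-b)..(-h), G y) + ∫ y in h..b, G y) := by
    rw [split F a iF, split G b iG, intervalIntegral.integral_sub (iF _ _) (iG _ _)]
    ring
  have p0 := piece (fun y => F y - G y) K (-h) h (by linarith)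
    fun y h1 h2 => hK y (abs_le.2 ⟨h1, h2⟩)
  have p1 := piece F A (-a) (-h) (by linarith)
    fun y h1 h2 => hA y (neg h1 h2).1 (neg h1 h2).2
  have p2 := piece F A h a ha fun y h1 h2 => hA y (pos h1 h2).1 (pos h1 h2).2
  have p3 := piece G B (-b) (-h) (by linarith)
    fun y h1 h2 => hB y (neg h1 h2).1 (neg h1 h2).2
  have p4 := piece G B h b hb fun y h1 h2 => hB y (pos h1 h2).1 (pos h1 h2).2
  rw [e]
  refine (norm_sub_le _ _).trans ?_
  refine (add_le_add ((norm_add_le _ _).trans (add_le_add p0 ((norm_add_le _ _).trans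
    (add_le_add p1 p2)))) ((norm_add_le _ _).trans (add_le_add p3 p4))).trans ?_
  linarith

lemma eta_pow_six_le {n : ℕ} (hn : 0 < n) : eta n ^ 6 ≤ 3 / 5 / (n : ℝ) ^ 3 := by
  have hn' : (0 : ℝ) < n := by exact_mod_cast hn
  have hp : Real.pi ^ 2 / 12 ≤ 0.83 := by nlinarith [Real.pi_pos, Real.pi_lt_d2]
  have e : eta n ^ 6 = (Real.pi ^ 2 / 12) ^ 3 / (n : ℝ) ^ 3 := by
    rw [show eta n ^ 6 = (eta n ^ 2) ^ 3 by ring, eta_sq]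
    field_simp
  rw [e]
  gcongr
  calc (Real.pi ^ 2 / 12) ^ 3 ≤ 0.83 ^ 3 := by gcongr
    _ ≤ 3 / 5 := by norm_num

end

end DistinctParts

theorem theorem1p3 (r t n : ℕ) (ht : 2 ≤ t) (hr : 1 ≤ r) (hrt : r ≤ t)
    (hn : 400 * (t : ℝ) ^ 2 / 3 < (n : ℝ)) :
    ‖(DistinctParts.D r t n : ℂ)
        - ((Real.log 2 / (t : ℝ) : ℝ) : ℂ) * DistinctParts.V 0 n
        + ((1 / 2 * DistinctParts.bern 1 ((r : ℝ) / (t : ℝ)) : ℝ) : ℂ) * DistinctParts.V 1 n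
        - (((t : ℝ) / 8 * DistinctParts.bern 2 ((r : ℝ) / (t : ℝ)) : ℝ) : ℂ) * DistinctParts.V 2 n
        + (((t : ℝ) ^ 3 / 192 * DistinctParts.bern 4 ((r : ℝ) / (t : ℝ)) : ℝ) : ℂ)
            * DistinctParts.V 4 n‖
      ≤ DistinctParts.Err t n := by
  open DistinctParts in
  have ht1 : 1 ≤ t := by omega
  have hn' : (0 : ℝ) < n := lt_of_le_of_lt (by positivity) hn
  have hn0 : 0 < n := by exact_mod_cast hn'
  have hn1 : (1 : ℝ) ≤ n := by exact_mod_cast hn0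
  have ht0 : (0 : ℝ) < t := by exact_mod_cast (by omega : 0 < t)
  have hη := eta_pos hn0
  have hη1 := eta_le ht hn
  have hV := sum_V_eq (r := r) ht1 hn0
  have hD : ∫ y in (-Real.pi)..Real.pi, cauchyIntegrand r t n (arcPoint n y)
      = 2 * (Real.pi : ℂ) * (D r t n : ℂ) := integral_eq_D hr hrt n hη
  have hpi : (Real.pi : ℂ) ≠ 0 := by exact_mod_cast Real.pi_ne_zero
  have hmain := norm_integral_sub_integral_le
    (continuous_cauchyIntegrand hr hrt hn0)
    ((continuous_arcFactor hn0).mul (continuous_lambertMain (r := r) ht1 hn0))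
    (h := eta n / 2) (a := Real.pi) (b := 10 * eta n)
    (K := 63000 * (t * eta n) ^ 5 * Real.exp (2 * (n * eta n)))
    (A := 4 / 3 * n * Real.exp (3 / 4 / eta n + n * eta n))
    (B := Real.exp (3 / 4 / eta n + n * eta n) * (1 / 2 / eta n))
    (by positivity) (by linarith [Real.pi_gt_three]) (by linarith)
    (fun y hy => norm_cauchyIntegrand_sub_le ht hr hrt hn hn0 hy)
    (fun y hy hy' => norm_cauchyIntegrand_le_of_outer hr hrt hn0 hη1 hy hy')
    (fun y hy hy' => by
      simp only [Pi.mul_apply, norm_mul]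
      exact mul_le_mul (norm_arcFactor_le_of_outer hn0 hη1 hy)
        (norm_lambertMain_le ht hrt hn hn0 hy') (norm_nonneg _) (Real.exp_pos _).le)
  have e : (D r t n : ℂ) - ((Real.log 2 / (t : ℝ) : ℝ) : ℂ) * V 0 n
        + ((1 / 2 * bern 1 ((r : ℝ) / (t : ℝ)) : ℝ) : ℂ) * V 1 n
        - (((t : ℝ) / 8 * bern 2 ((r : ℝ) / (t : ℝ)) : ℝ) : ℂ) * V 2 n
        + (((t : ℝ) ^ 3 / 192 * bern 4 ((r : ℝ) / (t : ℝ)) : ℝ) : ℂ) * V 4 n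
      = 1 / (2 * (Real.pi : ℂ)) * ((∫ y in (-Real.pi)..Real.pi, cauchyIntegrand r t n (arcPoint n y))
        - ∫ y in (-(10 * eta n))..(10 * eta n),
          arcFactor n (arcPoint n y) * lambertMain r t (arcPoint n y)) := by
    rw [mul_sub, ← hV, hD]
    field_simp
    ring
  have hnorm : ‖1 / (2 * (Real.pi : ℂ))‖ = 1 / (2 * Real.pi) := by
    rw [norm_div, norm_mul, norm_one, Complex.norm_real, Real.norm_of_nonneg Real.pi_pos.le]
    norm_num
  rw [e, norm_mul, hnorm, Err, main_exponent, outer_exponent hn0, one_div_mul_eq_div,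
    div_le_iff₀ (by positivity)]
  refine hmain.trans ?_
  set X := Real.exp (2 * (n * eta n))
  set Y := Real.exp (3 / 4 / eta n + n * eta n)
  have hX : 0 < X := Real.exp_pos _
  have hY : 0 < Y := Real.exp_pos _
  have h3 := Real.pi_gt_three
  have inner : 63000 * (t * eta n) ^ 5 * X * (2 * (eta n / 2))
      ≤ 14381 * (t : ℝ) ^ 5 / (n : ℝ) ^ 3 * X * (2 * Real.pi) := by
    have e1 : 63000 * (t * eta n) ^ 5 * X * (2 * (eta n / 2))
        = 63000 * (t : ℝ) ^ 5 * X * eta n ^ 6 := by ring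
    rw [e1]
    calc 63000 * (t : ℝ) ^ 5 * X * eta n ^ 6
        ≤ 63000 * (t : ℝ) ^ 5 * X * (3 / 5 / (n : ℝ) ^ 3) := by
          gcongr; exact eta_pow_six_le hn0
      _ = 14381 * (t : ℝ) ^ 5 / (n : ℝ) ^ 3 * X * (37800 / 14381) := by ring
      _ ≤ _ := by gcongr; linarith
  have outer : 2 * (4 / 3 * n * Y * (Real.pi - eta n / 2))
      + 2 * (Y * (1 / 2 / eta n) * (10 * eta n - eta n / 2)) ≤ 9 * n * Y * (2 * Real.pi) := by
    have e1 : 2 * (Y * (1 / 2 / eta n) * (10 * eta n - eta n / 2)) = 19 / 2 * Y := by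
      field_simp; ring
    have e2 : 2 * (4 / 3 * n * Y * (Real.pi - eta n / 2)) ≤ 2 * (4 / 3 * n * Y * Real.pi) := by
      gcongr; linarith
    have e3 : Y * 1 ≤ Y * (n * Real.pi) := by
      gcongr
      nlinarith
    rw [e1]
    nlinarith [mul_pos hY (mul_pos hn' Real.pi_pos)]
  -- the error of the expansions fits into the first term, so the second only has to be nonnegative
  have extra : 0 ≤ 945285959087 / ((t : ℝ) * (n : ℝ) ^ 4) * X * (2 * Real.pi) := by positivity
  linarith
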